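/- Setting. Let $(X,\mu)$ be a $\sigma$-finite measure space and $\omega:X\to\mathbb{R}$ measurable with $\inf_{X}\omega>0$. For $s\in\mathbb{R}$ let $\mathcal{H}_s=L^2(X,\omega^s\,d\mu)$ with norm $\|\cdot\|_s$, $\mathcal{H}=\mathcal{H}_0$. Let $\mathcal{F}$ be the symmetric Fock space over $\mathcal{H}$, $d\Gamma(\omega)$ the second quantization of multiplication by $\omega$, and $\mathcal{F}_s$ the space of sequences $\Psi=(\Psi^{(n)})_n$ of symmetric $n$-particle functions with $\|(d\Gamma(\omega)+1)^{s/2}\Psi\|<\infty$; thus $\mathcal{F}_0=\mathcal{F}$ and $\mathcal{F}_2=\mathcal{D}(d\Gamma(\omega))$. For $f\in\mathcal{H}_{-1}$ the annihilation operator $a(f):\mathcal{F}_1\to\mathcal{F}$ is the bounded operator $$(a(f)\Psi)^{(n)}(k_1,\dots,k_n)=\sqrt{n+1}\int\overline{f(k)}\,\Psi^{(n+1)}(k_1,\dots,k_n,k)\,d\mu(k),$$ and $a^\dagger(f):\mathcal{F}\to\mathcal{F}_{-1}$ is its adjoint with respect to the pairing $(\Psi,\Phi)=\langle(d\Gamma(\omega)+1)^{-1/2}\Psi,(d\Gamma(\omega)+1)^{1/2}\Phi\rangle$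 of $\mathcal{F}_{-1}$ and $\mathcal{F}_1$. Let $\mathfrak{h}_e,\mathfrak{h}_g$ be finite-dimensional complex Hilbert spaces, $E_e\in\mathcal{B}(\mathfrak{h}_e)$ and $E_g\in\mathcal{B}(\mathfrak{h}_g)$ symmetric and nonnegative, $\Sigma_j^+\in\mathcal{B}(\mathfrak{h}_g,\mathfrak{h}_e)$ and $\Sigma_j^-=(\Sigma_j^+)^\dagger$ for $j=1,\dots,r$, $\lambda\in\mathbb{R}$, and $f_1,\dots,f_r\in\mathcal{H}_{-1}$. Put $h_s=E_s\otimes I+I\otimes d\Gamma(\omega)$ with $\mathcal{D}(h_s)=\mathfrak{h}_s\otimes\mathcal{D}(d\Gamma(\omega))$ for $s\in\{e,g\}$, extended to the scale $\mathfrak{h}_s\otimes\mathcal{F}_t$; let $$A_{\boldsymbol f}=\sum_{j=1}^r\Sigma_j^+\otimes a(f_j):\mathfrak{h}_g\otimes\mathcal{F}_1\to\mathfrak{h}_e\otimes\mathcal{F},\qquad A_{\boldsymbol f}^\dagger:\mathfrak{h}_e\otimes\mathcal{F}\to\mathfrak{h}_g\otimes\mathcal{F}_{-1}$$ with $A_{\boldsymbol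 f}^\dagger$ the adjoint for the pairing, and $$\mathcal{S}_{\boldsymbol f}(z)=A_{\boldsymbol f}(h_g-z)^{-1}A_{\boldsymbol f}^\dagger\in\mathcal{B}(\mathfrak{h}_e\otimes\mathcal{F}),\qquad \mathcal{G}_{\boldsymbol f}(z)=h_e-z-\lambda^2\mathcal{S}_{\boldsymbol f}(z)\ \text{ on }\mathcal{D}(h_e),$$ where $(h_g-z)^{-1}:\mathfrak{h}_g\otimes\mathcal{F}_{-1}\to\mathfrak{h}_g\otimes\mathcal{F}_1$. Let $H_{\boldsymbol f}$ be the operator on $(\mathfrak{h}_e\otimes\mathcal{F})\oplus(\mathfrak{h}_g\otimes\mathcal{F})$ with domain $$\mathcal{D}(H_{\boldsymbol f})=\left\{\begin{pmatrix}\Phi_e\\ \Phi_g-\lambda(h_g+1)^{-1}A_{\boldsymbol f}^\dagger\Phi_e\end{pmatrix}:\ \Phi_e\in\mathcal{D}(h_e),\ \Phi_g\in\mathcal{D}(h_g)\right\}$$ and action $$H_{\boldsymbol f}\begin{pmatrix}\Phi_e\\ \Phi_g-\lambda(h_g+1)^{-1}A_{\boldsymbol f}^\dagger\Phi_e\end{pmatrix}=\begin{pmatrix}(h_e-\lambda^2\mathcal{S}_{\boldsymbol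 f}(-1))\Phi_e+\lambda A_{\boldsymbol f}\Phi_g\\ h_g\Phi_g+\lambda(h_g+1)^{-1}A_{\boldsymbol f}^\dagger\Phi_e\end{pmatrix}.$$ Claim. The operator $h_g+1:\mathfrak{h}_g\otimes\mathcal{F}_1\to\mathfrak{h}_g\otimes\mathcal{F}_{-1}$ is invertible, and: 1. $H_{\boldsymbol f}$ is self-adjoint. 2. For every $z\in\mathbb{C}\setminus\mathbb{R}$, $h_g-z:\mathfrak{h}_g\otimes\mathcal{F}_1\to\mathfrak{h}_g\otimes\mathcal{F}_{-1}$ is invertible, $\mathcal{G}_{\boldsymbol f}(z)$ has a bounded inverse, and $(H_{\boldsymbol f}-z)^{-1}$ is the bounded operator given, for all $\Psi_e\in\mathfrak{h}_e\otimes\mathcal{F}$ and $\Psi_g\in\mathfrak{h}_g\otimes\mathcal{F}$, by $$(H_{\boldsymbol f}-z)^{-1}\begin{pmatrix}\Psi_e\\ \Psi_g\end{pmatrix}=\begin{pmatrix}\chi\\ (h_g-z)^{-1}\Psi_g-\lambda(h_g-z)^{-1}A_{\boldsymbol f}^\dagger\chi\end{pmatrix},\qquad \chi=\mathcal{G}_{\boldsymbol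 f}(z)^{-1}\left(\Psi_e-\lambda A_{\boldsymbol f}(h_g-z)^{-1}\Psi_g\right).$$ 3. If $f_1,\dots,f_r\in\mathcal{H}$, then $H_{\boldsymbol f}$ equals (domain and action) the regular Hamiltonian $$\begin{pmatrix}h_e&0\\0&h_g\end{pmatrix}+\lambda\sum_{j=1}^r\left(\Sigma_j^+\otimes a(f_j)+\Sigma_j^-\otimes a^\dagger(f_j)\right),$$ where $a^\dagger(f_j)$ is the usual (unbounded) creation operator on $\mathcal{F}$, and the domain is $\mathcal{D}(h_e)\oplus\mathcal{D}(h_g)$. 4. There are sequences $(f_1^i)_{i\in\mathbb{N}},\dots,(f_r^i)_{i\in\mathbb{N}}\subset\mathcal{H}$ with $\|f_j^i-f_j\|_{-1}\to0$ as $i\to\infty$ for all $j$; and for all such sequences the regular Hamiltonians with form factors $f_1^i,\dots,f_r^i$ converge to $H_{\boldsymbol f}$ in the norm resolvent sense, that is, their resolvents at every $z\in\mathbb{C}\setminus\mathbb{R}$ converge in operator norm to that of $H_{\boldsymbol f}$. -/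

import Mathlib

open MeasureTheory Filter Topology
open scoped ENNReal NNReal ComplexConjugate

/-- A boson field: a `σ`-finite measure space `(X, μ)` with a measurable dispersion relation `ω`
of strictly positive mass, `inf ω > 0`. -/
structure BosonField (X : Type*) [MeasurableSpace X] where
  μ : Measure X
  sigmaFinite : SigmaFinite μ
  ω : X → ℝ
  measurable_ω : Measurable ω
  mass_pos : ∃ m : ℝ, 0 < m ∧ ∀ k, m ≤ ω k

attribute [instance] BosonField.sigmaFinite

/-- Configurations of finitely many bosons: the disjoint union of the spaces `X ^ n`. -/
abbrev Config (X : Type*) : Type _ := Σ n : ℕ, Fin n → X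

noncomputable section

namespace BosonField

variable {X : Type*} [MeasurableSpace X] (B : BosonField X)

theorem ω_pos (k : X) : 0 < B.ω k := by
  obtain ⟨m, hm, h⟩ := B.mass_pos
  exact hm.trans_le (h k)

/-- The one-particle scale `H_s = L²(X, ω^s dμ)`, with norm `‖f‖_s = ‖ω^(s/2) f‖`. -/
abbrev HScale (s : ℝ) : Type _ :=
  Lp ℂ 2 (B.μ.withDensity fun k => ENNReal.ofReal (B.ω k ^ s))

/-- The measure on configurations which is `μ^n` on the sector `X ^ n` (a unit mass for `n = 0`). -/
def configMeasure : Measure (Config X) :=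
  Measure.sum fun n => (Measure.pi fun _ : Fin n => B.μ).map (Sigma.mk n)

/-- The free energy `ω(k₁) + ⋯ + ω(kₙ)`; `dΓ(ω)` is multiplication by this function. -/
def energy (γ : Config X) : ℝ := ∑ i, B.ω (γ.2 i)

theorem energy_nonneg (γ : Config X) : 0 ≤ B.energy γ :=
  Finset.sum_nonneg fun _ _ => (B.ω_pos _).le

theorem measurable_sigma_mk (n : ℕ) : Measurable fun k : Fin n → X => (⟨n, k⟩ : Config X) :=
  fun _ hs => MeasurableSpace.measurableSet_iInf.1 hs n

theorem measurable_config {Y : Type*} [MeasurableSpace Y] {g : Config X → Y}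
    (h : ∀ n, Measurable fun k : Fin n → X => g ⟨n, k⟩) : Measurable g :=
  fun _ hs => MeasurableSpace.measurableSet_iInf.2 fun n => h n hs

theorem measurable_energy : Measurable B.energy :=
  measurable_config fun n => by
    unfold energy
    exact Finset.measurable_fun_sum Finset.univ
      fun (i : Fin n) _ => B.measurable_ω.comp (measurable_pi_apply i)

/-- The weighted measure `(dΓ(ω) + 1)^s dγ` on configurations. -/
def fockMeasure (s : ℝ) : Measure (Config X) :=
  B.configMeasure.withDensity fun γ => ENNReal.ofReal ((B.energy γ + 1) ^ s)

/-- Permutation of the particles, by `σ n` in the `n`-particle sector. -/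
def permute (σ : ∀ n, Equiv.Perm (Fin n)) (γ : Config X) : Config X := ⟨γ.1, γ.2 ∘ σ γ.1⟩

theorem energy_permute (σ : ∀ n, Equiv.Perm (Fin n)) (γ : Config X) :
    B.energy (permute σ γ) = B.energy γ :=
  Equiv.sum_comp (σ γ.1) fun i => B.ω (γ.2 i)

theorem measurable_weight (s : ℝ) :
    Measurable fun γ => ENNReal.ofReal ((B.energy γ + 1) ^ s) :=
  ((B.measurable_energy.add_const 1).pow_const s).ennreal_ofReal

theorem lintegral_config {g : Config X → ℝ≥0∞} (hg : Measurable g) :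
    ∫⁻ γ, g γ ∂B.configMeasure = ∑' n, ∫⁻ k, g ⟨n, k⟩ ∂Measure.pi fun _ : Fin n => B.μ := by
  rw [configMeasure, lintegral_sum_measure]
  congr with n
  rw [lintegral_map hg (measurable_sigma_mk n)]

theorem measurable_permute (σ : ∀ n, Equiv.Perm (Fin n)) :
    Measurable (permute σ : Config X → Config X) :=
  measurable_config fun n => (measurable_sigma_mk n).comp
    (measurable_pi_lambda _ fun i => measurable_pi_apply (σ n i))

theorem measurePreserving_perm {n : ℕ} (σ : Equiv.Perm (Fin n)) :
    MeasurePreserving (fun k : Fin n → X => k ∘ σ) (Measure.pi fun _ => B.μ)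
      (Measure.pi fun _ => B.μ) := by
  have := measurePreserving_piCongrLeft (fun _ : Fin n => B.μ) σ.symm
  convert this using 1
  ext k i
  obtain ⟨j, rfl⟩ := σ.symm.surjective i
  simp [MeasurableEquiv.coe_piCongrLeft, Equiv.piCongrLeft_apply_apply]

theorem measurePreserving_permute (σ : ∀ n, Equiv.Perm (Fin n)) :
    MeasurePreserving (permute σ) B.configMeasure B.configMeasure := by
  refine ⟨measurable_permute σ, Measure.ext fun s hs => ?_⟩
  rw [Measure.map_apply (measurable_permute σ) hs, configMeasure, Measure.sum_apply _ hs,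
    Measure.sum_apply _ (measurable_permute σ hs)]
  congr with n
  rw [Measure.map_apply (measurable_sigma_mk n) hs,
    Measure.map_apply (measurable_sigma_mk n) (measurable_permute σ hs)]
  exact (B.measurePreserving_perm (σ n)).measure_preimage
    (measurable_sigma_mk n hs).nullMeasurableSet

theorem fockMeasure_ac (s : ℝ) : B.fockMeasure s ≪ B.configMeasure :=
  withDensity_absolutelyContinuous _ _

theorem ac_fockMeasure (s : ℝ) : B.configMeasure ≪ B.fockMeasure s :=
  withDensity_absolutelyContinuous' (B.measurable_weight s).aemeasurable
    (ae_of_all _ fun γ => by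
      have := B.energy_nonneg γ
      simp only [ne_eq, ENNReal.ofReal_eq_zero, not_le]
      positivity)

theorem ae_fockMeasure_iff (s : ℝ) {p : Config X → Prop} :
    (∀ᵐ γ ∂B.fockMeasure s, p γ) ↔ ∀ᵐ γ ∂B.configMeasure, p γ :=
  ⟨fun h => B.ac_fockMeasure s h, fun h => B.fockMeasure_ac s h⟩

variable (h : Type*) [NormedAddCommGroup h] [InnerProductSpace ℂ h]

/-- `h ⊗ F_s`, realised as the space of `h`-valued functions `Ψ` on configurations which are
symmetric under permutations of the particles and satisfy
`∑ₙ ∫ ‖(dΓ(ω) + 1)^(s/2) Ψ⁽ⁿ⁾‖² dμⁿ < ∞`. For `s = 0` it is `h ⊗ F` with `F` the symmetric Fock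
space. -/
def fockSubmodule (s : ℝ) : Submodule ℂ (Lp h 2 (B.fockMeasure s)) where
  carrier := {Ψ | ∀ σ : ∀ n, Equiv.Perm (Fin n),
    ∀ᵐ γ ∂B.configMeasure, Ψ (permute σ γ) = Ψ γ}
  zero_mem' σ := by
    have h0 := (B.ae_fockMeasure_iff s).1 (Lp.coeFn_zero h 2 (B.fockMeasure s))
    filter_upwards [h0, (B.measurePreserving_permute σ).quasiMeasurePreserving.ae h0] with γ h1 h2
    rw [h1, h2]; rfl
  add_mem' {Ψ Φ} hΨ hΦ σ := by
    have h0 := (B.ae_fockMeasure_iff s).1 (Lp.coeFn_add Ψ Φ)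
    filter_upwards [h0, (B.measurePreserving_permute σ).quasiMeasurePreserving.ae h0, hΨ σ, hΦ σ]
      with γ h1 h2 h3 h4
    simp only [h1, h2, Pi.add_apply, h3, h4]
  smul_mem' c Ψ hΨ σ := by
    have h0 := (B.ae_fockMeasure_iff s).1 (Lp.coeFn_smul c Ψ)
    filter_upwards [h0, (B.measurePreserving_permute σ).quasiMeasurePreserving.ae h0, hΨ σ]
      with γ h1 h2 h3
    simp only [h1, h2, Pi.smul_apply, h3]

/-- `h ⊗ F_s`. -/
abbrev Fock (s : ℝ) : Type _ := ↥(B.fockSubmodule h s)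

theorem measurePreserving_permute_fock (s : ℝ) (σ : ∀ n, Equiv.Perm (Fin n)) :
    MeasurePreserving (permute σ) (B.fockMeasure s) (B.fockMeasure s) := by
  refine ⟨measurable_permute σ, Measure.ext fun t ht => ?_⟩
  rw [Measure.map_apply (measurable_permute σ) ht, fockMeasure, withDensity_apply _ ht,
    withDensity_apply _ (measurable_permute σ ht)]
  rw [← (B.measurePreserving_permute σ).setLIntegral_comp_preimage ht (B.measurable_weight s)]
  simp only [energy_permute]

theorem isClosed_fockSubmodule (s : ℝ) :
    IsClosed (B.fockSubmodule h s : Set (Lp h 2 (B.fockMeasure s))) := by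
  have : (B.fockSubmodule h s : Set (Lp h 2 (B.fockMeasure s))) = ⋂ σ : ∀ n, Equiv.Perm (Fin n),
      {Ψ | Lp.compMeasurePreserving (permute σ) (B.measurePreserving_permute_fock s σ) Ψ = Ψ} := by
    ext Ψ
    simp only [Set.mem_iInter, Set.mem_ofPred_eq]
    refine forall_congr' fun σ => ?_
    rw [Lp.ext_iff, ← B.ae_fockMeasure_iff s]
    have := Lp.coeFn_compMeasurePreserving Ψ (B.measurePreserving_permute_fock s σ)
    constructor
    · intro h1
      exact this.trans h1
    · intro h1
      exact this.symm.trans h1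
  rw [this]
  exact isClosed_iInter fun σ => isClosed_eq
    (Lp.isometry_compMeasurePreserving (B.measurePreserving_permute_fock s σ)).continuous
    continuous_id

instance [CompleteSpace h] (s : ℝ) : CompleteSpace (B.Fock h s) :=
  (B.isClosed_fockSubmodule h s).completeSpace_coe

variable {h}

theorem eLpNorm_fock_sq {s : ℝ} {g : Config X → h} :
    eLpNorm g 2 (B.fockMeasure s) ^ 2
      = ∫⁻ γ, ENNReal.ofReal ((B.energy γ + 1) ^ s) * ‖g γ‖ₑ ^ 2 ∂B.configMeasure := by
  have := eLpNorm_nnreal_pow_eq_lintegral (f := g) (μ := B.fockMeasure s) (p := 2) (by norm_num)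
  have h2 : (eLpNorm g 2 (B.fockMeasure s)) ^ 2 = ∫⁻ γ, ‖g γ‖ₑ ^ 2 ∂(B.fockMeasure s) := by
    simpa using this
  rw [h2, fockMeasure, lintegral_withDensity_eq_lintegral_mul_non_measurable _
    (B.measurable_weight s) (ae_of_all _ fun γ => ENNReal.ofReal_lt_top)]
  rfl

/-- The bounded operator `Ψ ↦ T Ψ` from `h ⊗ F_s` to `h' ⊗ F_t`, for `T` which respects a.e.
equality, linearity and symmetry and satisfies `‖T Ψ‖ ≤ C ‖Ψ‖`; see `coeFn_mkFock`. -/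
def mkFock {h' : Type*} [NormedAddCommGroup h'] [InnerProductSpace ℂ h'] {s t : ℝ}
    (T : (Config X → h) → Config X → h')
    (hmeas : ∀ Ψ : B.Fock h s, AEStronglyMeasurable (T Ψ.1) B.configMeasure)
    (C : ℝ≥0)
    (hbound : ∀ Ψ : B.Fock h s, eLpNorm (T Ψ.1) 2 (B.fockMeasure t) ≤
      C * eLpNorm Ψ.1 2 (B.fockMeasure s))
    (hsymm : ∀ (Ψ : B.Fock h s) (σ : ∀ n, Equiv.Perm (Fin n)),
      ∀ᵐ γ ∂B.configMeasure, T Ψ.1 (permute σ γ) = T Ψ.1 γ)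
    (hcongr : ∀ (Ψ Φ : Config X → h), Ψ =ᵐ[B.configMeasure] Φ → T Ψ =ᵐ[B.configMeasure] T Φ)
    (hadd : ∀ Ψ Φ : B.Fock h s, T (⇑Ψ.1 + ⇑Φ.1) =ᵐ[B.configMeasure] T Ψ.1 + T Φ.1)
    (hsmul : ∀ (c : ℂ) (Ψ : B.Fock h s), T (c • ⇑Ψ.1) =ᵐ[B.configMeasure] c • T Ψ.1) :
    B.Fock h s →L[ℂ] B.Fock h' t := by
  have hmem : ∀ Ψ : B.Fock h s, MemLp (T Ψ.1) 2 (B.fockMeasure t) := fun Ψ =>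
    ⟨(hmeas Ψ).mono_ac (B.fockMeasure_ac t), (hbound Ψ).trans_lt
      (ENNReal.mul_lt_top ENNReal.coe_lt_top (Lp.eLpNorm_lt_top _))⟩
  have hcoe : ∀ Ψ, (hmem Ψ).toLp =ᵐ[B.configMeasure] T Ψ.1 := fun Ψ =>
    (B.ae_fockMeasure_iff t).1 (hmem Ψ).coeFn_toLp
  refine LinearMap.mkContinuous
    { toFun := fun Ψ => ⟨(hmem Ψ).toLp, fun σ => ?_⟩
      map_add' := fun Ψ Φ => ?_
      map_smul' := fun c Ψ => ?_ } C fun Ψ => ?_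
  · filter_upwards [hcoe Ψ, (B.measurePreserving_permute σ).quasiMeasurePreserving.ae (hcoe Ψ),
      hsymm Ψ σ] with γ h1 h2 h3
    rw [h1, h2, h3]
  · apply Subtype.ext
    apply Lp.ext
    refine (B.ae_fockMeasure_iff t).2 ?_
    filter_upwards [hcoe (Ψ + Φ), hadd Ψ Φ, hcoe Ψ, hcoe Φ, (B.ae_fockMeasure_iff t).1
      (Lp.coeFn_add (hmem Ψ).toLp (hmem Φ).toLp), hcongr _ _ ((B.ae_fockMeasure_iff s).1
      (Lp.coeFn_add Ψ.1 Φ.1))] with γ h1 h2 h3 h4 h5 h6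
    rw [h1]
    simp only [Submodule.coe_add, h6, h2, h5, Pi.add_apply, h3, h4]
  · apply Subtype.ext
    apply Lp.ext
    refine (B.ae_fockMeasure_iff t).2 ?_
    filter_upwards [hcoe (c • Ψ), hsmul c Ψ, hcoe Ψ, (B.ae_fockMeasure_iff t).1
      (Lp.coeFn_smul c (hmem Ψ).toLp), hcongr _ _ ((B.ae_fockMeasure_iff s).1
      (Lp.coeFn_smul c Ψ.1))] with γ h1 h2 h3 h5 h6
    rw [h1]
    simp only [Submodule.coe_smul, h6, h2, h5, Pi.smul_apply, h3, RingHom.id_apply]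
  · simp only [LinearMap.coe_mk, AddHom.coe_mk, Submodule.coe_norm]
    rw [Lp.norm_toLp, Lp.norm_def]
    have := ENNReal.toReal_mono (ENNReal.mul_ne_top ENNReal.coe_ne_top
      (Lp.eLpNorm_ne_top Ψ.1)) (hbound Ψ)
    simpa using this


theorem coeFn_mkFock {h' : Type*} [NormedAddCommGroup h'] [InnerProductSpace ℂ h'] {s t : ℝ}
    (T : (Config X → h) → Config X → h') (h1 C h2 h3 h4 h5 h6) (Ψ : B.Fock h s) :
    ⇑(B.mkFock (s := s) (t := t) T h1 C h2 h3 h4 h5 h6 Ψ).1 =ᵐ[B.configMeasure] T Ψ.1 :=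
  (B.ae_fockMeasure_iff t).1 (MemLp.coeFn_toLp (f := T Ψ.1)
    ⟨(h1 Ψ).mono_ac (B.fockMeasure_ac t), (h2 Ψ).trans_lt
      (ENNReal.mul_lt_top ENNReal.coe_lt_top (Lp.eLpNorm_lt_top _))⟩)

theorem eLpNorm_fock_le {h' : Type*} [NormedAddCommGroup h'] [InnerProductSpace ℂ h'] {s t : ℝ} {Ψ : Config X → h}
    {Φ : Config X → h'} {C : ℝ≥0}
    (hb : ∫⁻ γ, ENNReal.ofReal ((B.energy γ + 1) ^ t) * ‖Φ γ‖ₑ ^ 2 ∂B.configMeasure ≤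
      C ^ 2 * ∫⁻ γ, ENNReal.ofReal ((B.energy γ + 1) ^ s) * ‖Ψ γ‖ₑ ^ 2 ∂B.configMeasure) :
    eLpNorm Φ 2 (B.fockMeasure t) ≤ C * eLpNorm Ψ 2 (B.fockMeasure s) := by
  rw [← B.eLpNorm_fock_sq, ← B.eLpNorm_fock_sq, ← mul_pow] at hb
  exact (ENNReal.pow_le_pow_left_iff two_ne_zero).1 hb

/-- The function `φ(dΓ(ω))` of the free field energy, as a bounded map `h ⊗ F_s → h ⊗ F_t`. -/
def energyFn {s t : ℝ} (φ : ℝ → ℝ) (hφ : Measurable φ)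
    (hb : ∀ x : ℝ, 0 ≤ x → φ x ^ 2 * (x + 1) ^ t ≤ (x + 1) ^ s) :
    B.Fock h s →L[ℂ] B.Fock h t :=
  B.mkFock (fun Ψ γ => (φ (B.energy γ) : ℂ) • Ψ γ)
    (fun Ψ => ((Complex.measurable_ofReal.comp (hφ.comp B.measurable_energy)).aestronglyMeasurable).smul
      (Lp.stronglyMeasurable Ψ.1).aestronglyMeasurable)
    1
    (fun Ψ => B.eLpNorm_fock_le <| by
      simp only [ENNReal.coe_one, one_pow, one_mul]
      refine lintegral_mono fun γ => ?_
      have h0 := B.energy_nonneg γ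
      rw [enorm_smul, mul_pow, ← mul_assoc]
      gcongr
      rw [← ofReal_norm, Complex.norm_real, Real.norm_eq_abs, ← ENNReal.ofReal_pow (abs_nonneg _), sq_abs,
        ← ENNReal.ofReal_mul (by positivity), mul_comm]
      exact ENNReal.ofReal_le_ofReal (hb _ h0))
    (fun Ψ σ => (Ψ.2 σ).mono fun γ hγ => by simp only [energy_permute, hγ])
    (fun Ψ Φ hΨ => hΨ.mono fun γ hγ => by simp only [hγ])
    (fun Ψ Φ => ae_of_all _ fun γ => by simp only [Pi.add_apply, smul_add])
    (fun c Ψ => ae_of_all _ fun γ => by simp only [Pi.smul_apply, smul_comm c])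

/-- The operator `L ⊗ I`, for `L` acting on the atom. -/
def atomOp {h' : Type*} [NormedAddCommGroup h'] [InnerProductSpace ℂ h'] (s : ℝ) (L : h →L[ℂ] h') :
    B.Fock h s →L[ℂ] B.Fock h' s :=
  B.mkFock (fun Ψ γ => L (Ψ γ))
    (fun Ψ => L.continuous.comp_aestronglyMeasurable (Lp.stronglyMeasurable Ψ.1).aestronglyMeasurable)
    ‖L‖₊
    (fun Ψ => eLpNorm_le_nnreal_smul_eLpNorm_of_ae_le_mul
      (ae_of_all _ fun γ => L.le_opNNNorm _) 2)
    (fun Ψ σ => (Ψ.2 σ).mono fun γ hγ => by simp only [hγ])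
    (fun Ψ Φ hΨ => hΨ.mono fun γ hγ => by simp only [hγ])
    (fun Ψ Φ => ae_of_all _ fun γ => by simp only [Pi.add_apply, map_add])
    (fun c Ψ => ae_of_all _ fun γ => by simp only [Pi.smul_apply, map_smul])

/-- The formula `(a(f)Ψ)(k₁,…,kₙ) = √(n+1) ∫ conj (f(k')) Ψ(k₁,…,kₙ,k') dμ(k')`. -/
def annihilationFun (f : X → ℂ) (Ψ : Config X → h) (γ : Config X) : h :=
  (√(γ.1 + 1 : ℝ) : ℂ) • ∫ k', conj (f k') • Ψ ⟨γ.1 + 1, Fin.snoc γ.2 k'⟩ ∂B.μ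

theorem measurePreserving_snoc (n : ℕ) :
    MeasurePreserving (fun p : (Fin n → X) × X => (Fin.snoc p.1 p.2 : Fin (n + 1) → X))
      ((Measure.pi fun _ => B.μ).prod B.μ) (Measure.pi fun _ => B.μ) := by
  have h1 := (measurePreserving_piFinSuccAbove (fun _ : Fin (n + 1) => B.μ) (Fin.last n)).symm
  have h2 := h1.comp (Measure.measurePreserving_swap
    (μ := Measure.pi fun _ : Fin n => B.μ) (ν := B.μ))
  convert h2 using 1
  ext p i
  simp [MeasurableEquiv.piFinSuccAbove, Fin.insertNthEquiv, Fin.insertNth_last']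

theorem measurable_snoc_right (γ : Config X) :
    Measurable fun k' : X => (⟨γ.1 + 1, Fin.snoc γ.2 k'⟩ : Config X) := by
  refine (measurable_sigma_mk (γ.1 + 1)).comp (measurable_pi_lambda _ fun i => ?_)
  refine Fin.lastCases ?_ (fun j => ?_) i
  · simpa using measurable_id'
  · simp

/-- The extension of a permutation of `n` particles to one of `n + 1` which fixes the last. -/
def extendPerm (σ : ∀ n, Equiv.Perm (Fin n)) : ∀ n, Equiv.Perm (Fin n)
  | 0 => 1
  | n + 1 => (finSuccEquivLast.trans (Equiv.optionCongr (σ n))).trans finSuccEquivLast.symm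

theorem permute_extendPerm (σ : ∀ n, Equiv.Perm (Fin n)) (γ : Config X) (k' : X) :
    permute (extendPerm σ) (⟨γ.1 + 1, Fin.snoc γ.2 k'⟩ : Config X)
      = ⟨(permute σ γ).1 + 1, Fin.snoc (permute σ γ).2 k'⟩ := by
  obtain ⟨n, k⟩ := γ
  simp only [permute, extendPerm]
  congr 1
  ext i
  refine Fin.lastCases ?_ (fun j => ?_) i <;> simp

theorem measurableEmbedding_sigma_mk (n : ℕ) :
    MeasurableEmbedding fun k : Fin n → X => (⟨n, k⟩ : Config X) where
  injective := sigma_mk_injective (β := fun n => Fin n → X)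
  measurable := measurable_sigma_mk n
  measurableSet_image' t ht := by
    refine MeasurableSpace.measurableSet_iInf.2 fun m => ?_
    change MeasurableSet
      ((Sigma.mk (β := fun n => Fin n → X) m) ⁻¹' ((Sigma.mk (β := fun n => Fin n → X) n) '' t))
    by_cases hmn : n = m
    · subst hmn
      rwa [Set.preimage_image_eq _ sigma_mk_injective]
    · rw [Set.preimage_image_sigmaMk_of_ne (Ne.symm hmn)]
      exact MeasurableSet.empty

theorem ae_config_iff {p : Config X → Prop} : (∀ᵐ γ ∂B.configMeasure, p γ) ↔
    ∀ n, ∀ᵐ k ∂(Measure.pi fun _ : Fin n => B.μ), p ⟨n, k⟩ := by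
  rw [configMeasure, Measure.ae_sum_iff]
  exact forall_congr' fun n => (measurableEmbedding_sigma_mk n).ae_map_iff

theorem ae_snoc {p : Config X → Prop} (hp : ∀ᵐ γ ∂B.configMeasure, p γ) :
    ∀ᵐ γ ∂B.configMeasure, ∀ᵐ k' ∂B.μ, p ⟨γ.1 + 1, Fin.snoc γ.2 k'⟩ :=
  B.ae_config_iff.2 fun n => Measure.ae_ae_of_ae_prod
    ((B.measurePreserving_snoc n).quasiMeasurePreserving.ae (B.ae_config_iff.1 hp (n + 1)))

theorem aestronglyMeasurable_annihilationFun {f : X → ℂ} (hf : StronglyMeasurable f)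
    {Ψ : Config X → h} (hΨ : StronglyMeasurable Ψ) :
    AEStronglyMeasurable (annihilationFun B f Ψ) B.configMeasure := by
  rw [configMeasure, aestronglyMeasurable_sum_measure_iff]
  intro n
  rw [(measurableEmbedding_sigma_mk n).aestronglyMeasurable_map_iff]
  refine StronglyMeasurable.aestronglyMeasurable ?_
  have h1 : StronglyMeasurable fun p : (Fin n → X) × X =>
      conj (f p.2) • Ψ ⟨n + 1, Fin.snoc p.1 p.2⟩ :=
    (Complex.continuous_conj.comp_stronglyMeasurable (hf.comp_measurable measurable_snd)).smul
      (hΨ.comp_measurable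
        ((measurable_sigma_mk (n + 1)).comp (B.measurePreserving_snoc n).measurable))
  exact (h1.integral_prod_right).const_smul (√(n + 1 : ℝ) : ℂ)

theorem lintegral_fiber_sq_le {f : X → ℂ} (hf : StronglyMeasurable f) {g : X → h}
    (hg : StronglyMeasurable g) :
    (∫⁻ k, ‖conj (f k) • g k‖ₑ ∂B.μ) ^ 2 ≤
      (eLpNorm f 2 (B.μ.withDensity fun k => ENNReal.ofReal (B.ω k ^ (-1 : ℝ)))) ^ 2
        * ∫⁻ k, ENNReal.ofReal (B.ω k) * ‖g k‖ₑ ^ 2 ∂B.μ := by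
  have hn := eLpNorm_nnreal_pow_eq_lintegral (f := f)
    (μ := B.μ.withDensity fun k => ENNReal.ofReal (B.ω k ^ (-1 : ℝ))) (p := 2) (by norm_num)
  have hn2 : (eLpNorm f 2 (B.μ.withDensity fun k => ENNReal.ofReal (B.ω k ^ (-1 : ℝ)))) ^ 2
      = ∫⁻ k, ENNReal.ofReal (B.ω k)⁻¹ * ‖f k‖ₑ ^ 2 ∂B.μ := by
    have h2 : (eLpNorm f 2 (B.μ.withDensity fun k => ENNReal.ofReal (B.ω k ^ (-1 : ℝ)))) ^ 2
      = ∫⁻ γ, ‖f γ‖ₑ ^ 2 ∂(B.μ.withDensity fun k => ENNReal.ofReal (B.ω k ^ (-1 : ℝ))) := by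
      simpa using hn
    rw [h2, lintegral_withDensity_eq_lintegral_mul_non_measurable _
      (by have := B.measurable_ω; fun_prop) (ae_of_all _ fun γ => ENNReal.ofReal_lt_top)]
    simp [Real.rpow_neg_one]
  rw [hn2]
  have H := ENNReal.lintegral_mul_le_Lp_mul_Lq B.μ Real.HolderConjugate.two_two
    (f := fun k => ENNReal.ofReal (√(B.ω k))⁻¹ * ‖f k‖ₑ)
    (g := fun k => ENNReal.ofReal (√(B.ω k)) * ‖g k‖ₑ)
    (((B.measurable_ω.sqrt.inv).ennreal_ofReal.mul hf.enorm).aemeasurable)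
    (((B.measurable_ω.sqrt).ennreal_ofReal.mul hg.enorm).aemeasurable)
  have e1 : ∀ k, ENNReal.ofReal (√(B.ω k))⁻¹ * ENNReal.ofReal (√(B.ω k)) = 1 := fun k => by
    have := Real.sqrt_pos.2 (B.ω_pos k)
    rw [← ENNReal.ofReal_mul (by positivity), inv_mul_cancel₀ this.ne', ENNReal.ofReal_one]
  have e2 : ∀ k, ENNReal.ofReal (√(B.ω k)) ^ 2 = ENNReal.ofReal (B.ω k) := fun k => by
    rw [← ENNReal.ofReal_pow (Real.sqrt_nonneg _), Real.sq_sqrt (B.ω_pos k).le]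
  have e3 : ∀ k, ENNReal.ofReal (√(B.ω k))⁻¹ ^ 2 = ENNReal.ofReal (B.ω k)⁻¹ := fun k => by
    rw [← ENNReal.ofReal_pow (by positivity), inv_pow, Real.sq_sqrt (B.ω_pos k).le]
  have e4 : ∀ k, ‖conj (f k) • g k‖ₑ = ENNReal.ofReal (√(B.ω k))⁻¹ * ‖f k‖ₑ *
      (ENNReal.ofReal (√(B.ω k)) * ‖g k‖ₑ) := fun k => by
    rw [mul_mul_mul_comm, e1, one_mul, enorm_smul]
    congr 1
    exact RCLike.enorm_conj _
  simp only [ENNReal.rpow_two, mul_pow, e2, e3, Pi.mul_apply, ← e4] at H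
  calc _ ≤ _ := pow_le_pow_left' H 2
    _ = _ := by
      rw [mul_pow, ← ENNReal.rpow_two, ← ENNReal.rpow_two, ← ENNReal.rpow_mul, ← ENNReal.rpow_mul]
      norm_num

theorem lintegral_symm {n : ℕ} {G : (Fin (n + 1) → X) → ℝ≥0∞} (hG : Measurable G)
    (hs : ∀ σ : Equiv.Perm (Fin (n + 1)), ∀ᵐ k ∂(Measure.pi fun _ => B.μ), G (k ∘ σ) = G k) :
    (n + 1) * ∫⁻ k, ENNReal.ofReal (B.ω (k (Fin.last n))) * G k ∂(Measure.pi fun _ => B.μ)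
      = ∫⁻ k, ENNReal.ofReal (B.energy ⟨n + 1, k⟩) * G k ∂(Measure.pi fun _ => B.μ) := by
  have hω := B.measurable_ω
  have h1 : ∀ j : Fin (n + 1),
      ∫⁻ k, ENNReal.ofReal (B.ω (k j)) * G k ∂(Measure.pi fun _ => B.μ)
        = ∫⁻ k, ENNReal.ofReal (B.ω (k (Fin.last n))) * G k ∂(Measure.pi fun _ => B.μ) := by
    intro j
    rw [← (B.measurePreserving_perm (Equiv.swap j (Fin.last n))).lintegral_comp
      (by fun_prop)]
    refine lintegral_congr_ae ?_
    filter_upwards [hs (Equiv.swap j (Fin.last n))] with k hk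
    simp [hk]
  have h2 : ∀ k : Fin (n + 1) → X, ENNReal.ofReal (B.energy ⟨n + 1, k⟩) * G k
      = ∑ j, ENNReal.ofReal (B.ω (k j)) * G k := fun k => by
    rw [energy, ENNReal.ofReal_sum_of_nonneg fun i _ => (B.ω_pos _).le, Finset.sum_mul]
  simp_rw [h2]
  rw [lintegral_finsetSum _ (fun j _ => by fun_prop), Finset.sum_congr rfl fun j _ => h1 j]
  simp

theorem lintegral_annihilation {Ψ : Config X → h} (hΨ : StronglyMeasurable Ψ)
    (hs : ∀ σ : ∀ n, Equiv.Perm (Fin n), ∀ᵐ γ ∂B.configMeasure, Ψ (permute σ γ) = Ψ γ) :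
    ∫⁻ γ, (γ.1 + 1) * ∫⁻ k, ENNReal.ofReal (B.ω k) * ‖Ψ ⟨γ.1 + 1, Fin.snoc γ.2 k⟩‖ₑ ^ 2 ∂B.μ
        ∂B.configMeasure
      ≤ ∫⁻ γ, ENNReal.ofReal ((B.energy γ + 1) ^ (1 : ℝ)) * ‖Ψ γ‖ₑ ^ 2 ∂B.configMeasure := by
  have hω := B.measurable_ω
  have hme : ∀ n, Measurable fun k : Fin n → X => ‖Ψ ⟨n, k⟩‖ₑ ^ 2 := fun n =>
    (hΨ.enorm.comp (measurable_sigma_mk n)).pow_const 2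
  have hm : ∀ n, Measurable fun p : (Fin n → X) × X =>
      ENNReal.ofReal (B.ω p.2) * ‖Ψ ⟨n + 1, Fin.snoc p.1 p.2⟩‖ₑ ^ 2 := fun n =>
    (hω.comp measurable_snd).ennreal_ofReal.mul
      ((hme (n + 1)).comp (B.measurePreserving_snoc n).measurable)
  have hm2 : ∀ n, Measurable fun k : Fin n → X =>
      ∫⁻ k', ENNReal.ofReal (B.ω k') * ‖Ψ ⟨n + 1, Fin.snoc k k'⟩‖ₑ ^ 2 ∂B.μ := fun n =>
    (hm n).lintegral_prod_right'
  rw [lintegral_config, lintegral_config]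
  rotate_left
  · exact (B.measurable_weight 1).mul (hΨ.enorm.pow_const 2)
  · exact measurable_config fun n => (hm2 n).const_mul ((n : ℝ≥0∞) + 1)
  refine le_trans (ENNReal.tsum_le_tsum fun n => ?_)
    (ENNReal.tsum_comp_le_tsum_of_injective (Nat.succ_injective) _)
  change ∫⁻ k : Fin n → X, ((n : ℝ≥0∞) + 1) * ∫⁻ k', ENNReal.ofReal (B.ω k') *
    ‖Ψ ⟨n + 1, Fin.snoc k k'⟩‖ₑ ^ 2 ∂B.μ ∂(Measure.pi fun _ => B.μ) ≤ _
  rw [lintegral_const_mul _ (hm2 n), ← lintegral_prod _ (hm n).aemeasurable]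
  have h3 : ∫⁻ p : (Fin n → X) × X, ENNReal.ofReal (B.ω p.2) * ‖Ψ ⟨n + 1, Fin.snoc p.1 p.2⟩‖ₑ ^ 2
      ∂((Measure.pi fun _ => B.μ).prod B.μ) = ∫⁻ k : Fin (n + 1) → X,
        ENNReal.ofReal (B.ω (k (Fin.last n))) * ‖Ψ ⟨n + 1, k⟩‖ₑ ^ 2 ∂(Measure.pi fun _ => B.μ) := by
    have hm3 : Measurable fun k : Fin (n + 1) → X =>
        ENNReal.ofReal (B.ω (k (Fin.last n))) * ‖Ψ ⟨n + 1, k⟩‖ₑ ^ 2 :=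
      (hω.comp (measurable_pi_apply _)).ennreal_ofReal.mul (hme (n + 1))
    rw [← (B.measurePreserving_snoc n).lintegral_comp hm3]
    simp
  rw [h3, B.lintegral_symm (hme (n + 1))]
  · refine lintegral_mono fun k => ?_
    simp only [Real.rpow_one]
    gcongr
    linarith
  · intro σ
    have := B.ae_config_iff.1 (hs fun m => if hm : m = n + 1 then hm ▸ σ else 1) (n + 1)
    filter_upwards [this] with k hk
    simp only [permute] at hk
    simp only [dite_true] at hk
    rw [hk]

theorem integrable_fiber (f : B.HScale (-1)) (Ψ : B.Fock h 1) :
    ∀ᵐ γ ∂B.configMeasure,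
      Integrable (fun k' => conj (f k') • Ψ.1 ⟨γ.1 + 1, Fin.snoc γ.2 k'⟩) B.μ := by
  have hf := Lp.stronglyMeasurable f
  have hΨ := Lp.stronglyMeasurable Ψ.1
  have hω := B.measurable_ω
  have hg : ∀ γ : Config X, StronglyMeasurable
      fun k' : X => Ψ.1 (⟨γ.1 + 1, Fin.snoc γ.2 k'⟩ : Config X) := fun γ =>
    hΨ.comp_measurable (measurable_snoc_right γ)
  have hfin := (B.lintegral_annihilation hΨ Ψ.2).trans_lt (by
    rw [← B.eLpNorm_fock_sq]
    exact ENNReal.pow_lt_top (Lp.eLpNorm_lt_top Ψ.1))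
  have hmeas : Measurable fun γ : Config X => ((γ.1 : ℝ≥0∞) + 1) *
      ∫⁻ k, ENNReal.ofReal (B.ω k) * ‖Ψ.1 ⟨γ.1 + 1, Fin.snoc γ.2 k⟩‖ₑ ^ 2 ∂B.μ := by
    refine measurable_config fun n => ?_
    have hm : Measurable fun p : (Fin n → X) × X =>
        ENNReal.ofReal (B.ω p.2) * ‖Ψ.1 ⟨n + 1, Fin.snoc p.1 p.2⟩‖ₑ ^ 2 :=
      (hω.comp measurable_snd).ennreal_ofReal.mul
        (((hΨ.enorm.comp (measurable_sigma_mk (n + 1))).pow_const 2).comp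
          (B.measurePreserving_snoc n).measurable)
    have hm2 : Measurable fun k : Fin n → X => ∫⁻ k', ENNReal.ofReal (B.ω k') *
        ‖Ψ.1 ⟨n + 1, Fin.snoc k k'⟩‖ₑ ^ 2 ∂B.μ := hm.lintegral_prod_right'
    exact hm2.const_mul ((n : ℝ≥0∞) + 1)
  filter_upwards [ae_lt_top hmeas hfin.ne] with γ hγ
  refine ⟨((Complex.continuous_conj.comp_stronglyMeasurable hf).smul (hg γ)).aestronglyMeasurable,
    ?_⟩
  have h1 := B.lintegral_fiber_sq_le hf (hg γ)
  have h2 : ∫⁻ k, ENNReal.ofReal (B.ω k) * ‖Ψ.1 ⟨γ.1 + 1, Fin.snoc γ.2 k⟩‖ₑ ^ 2 ∂B.μ < ∞ :=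
    lt_of_le_of_lt (le_mul_of_one_le_left' (by simp)) hγ
  have h3 := h1.trans_lt (ENNReal.mul_lt_top (ENNReal.pow_lt_top (Lp.eLpNorm_lt_top f)) h2)
  rw [hasFiniteIntegral_iff_enorm]
  exact (ENNReal.pow_lt_top_iff.1 h3).resolve_right two_ne_zero

/-- The annihilation operator `a(f) : h ⊗ F_1 → h ⊗ F` of a form factor `f ∈ H_{-1}`
(more precisely `I ⊗ a(f)`), a bounded operator. -/
def annihilation (f : B.HScale (-1)) : B.Fock h 1 →L[ℂ] B.Fock h 0 :=
  B.mkFock (B.annihilationFun f)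
    (fun Ψ => B.aestronglyMeasurable_annihilationFun (Lp.stronglyMeasurable f)
      (Lp.stronglyMeasurable Ψ.1))
    ‖f‖₊
    (fun Ψ => B.eLpNorm_fock_le <| by
      have hΨ := Lp.stronglyMeasurable Ψ.1
      have hf := Lp.stronglyMeasurable f
      refine le_trans ?_ (mul_le_mul_right (B.lintegral_annihilation hΨ Ψ.2) _)
      rw [← lintegral_const_mul' _ _ (by finiteness)]
      refine lintegral_mono fun γ => ?_
      have hg : StronglyMeasurable
          fun k' : X => Ψ.1 (⟨γ.1 + 1, Fin.snoc γ.2 k'⟩ : Config X) :=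
        hΨ.comp_measurable (measurable_snoc_right γ)
      have h1 := (pow_le_pow_left' (enorm_integral_le_lintegral_enorm
        (μ := B.μ) fun k' => conj (f k') • Ψ.1 ⟨γ.1 + 1, Fin.snoc γ.2 k'⟩) 2).trans
        (B.lintegral_fiber_sq_le hf hg)
      have h2 : ‖(√(γ.1 + 1 : ℝ) : ℂ)‖ₑ ^ 2 = γ.1 + 1 := by
        rw [← ofReal_norm, Complex.norm_real, Real.norm_eq_abs, ← ENNReal.ofReal_pow (abs_nonneg _),
          sq_abs, Real.sq_sqrt (by positivity), ENNReal.ofReal_add (by positivity) zero_le_one]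
        simp
      have h3 : eLpNorm f 2 (B.μ.withDensity fun k => ENNReal.ofReal (B.ω k ^ (-1 : ℝ))) = ‖f‖₊ :=
        (Lp.enorm_def f).symm
      rw [Real.rpow_zero, ENNReal.ofReal_one, one_mul, annihilationFun, enorm_smul, mul_pow, h2,
        mul_left_comm, ← h3]
      gcongr)
    (fun Ψ σ => (B.ae_snoc (Ψ.2 (extendPerm σ))).mono fun γ hγ => by
      unfold annihilationFun
      congr 1
      refine integral_congr_ae (hγ.mono fun k hk => ?_)
      simp only [permute_extendPerm] at hk
      simp only [hk])
    (fun Ψ Φ hΨ => (B.ae_snoc hΨ).mono fun γ hγ => by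
      unfold annihilationFun
      congr 1
      exact integral_congr_ae (hγ.mono fun k hk => by simp only [hk]))
    (fun Ψ Φ => by
      filter_upwards [B.integrable_fiber f Ψ, B.integrable_fiber f Φ] with γ h1 h2
      simp only [annihilationFun, Pi.add_apply, smul_add]
      rw [integral_add h1 h2, smul_add])
    (fun c Ψ => ae_of_all _ fun γ => by
      simp only [annihilationFun, Pi.smul_apply]
      simp_rw [smul_comm _ c]
      rw [integral_smul, smul_comm])

/-- The natural inclusion `h ⊗ F_s ⊆ h ⊗ F_t`, `t ≤ s`. -/
def incl {s t : ℝ} (hts : t ≤ s) : B.Fock h s →L[ℂ] B.Fock h t :=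
  B.energyFn (fun _ => 1) measurable_const fun x hx => by
    simpa using Real.rpow_le_rpow_of_exponent_le (by linarith) hts

/-- The second quantization `dΓ(ω) : h ⊗ F_s → h ⊗ F_t`, `t ≤ s - 2`. -/
def dΓ {s t : ℝ} (hts : t + 2 ≤ s) : B.Fock h s →L[ℂ] B.Fock h t :=
  B.energyFn (fun x => x) measurable_id fun x hx => by
    calc x ^ 2 * (x + 1) ^ t ≤ (x + 1) ^ 2 * (x + 1) ^ t := by gcongr; linarith
      _ = (x + 1) ^ (t + 2) := by
        rw [← Real.rpow_two, ← Real.rpow_add (by linarith), add_comm t 2]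
      _ ≤ _ := Real.rpow_le_rpow_of_exponent_le (by linarith) hts

/-- The power `(dΓ(ω) + 1)^r : h ⊗ F_s → h ⊗ F_t`, `t = s - 2r`. -/
def numPow (r : ℝ) {s t : ℝ} (hts : t = s - 2 * r) : B.Fock h s →L[ℂ] B.Fock h t :=
  B.energyFn (fun x => (x + 1) ^ r) (by fun_prop) fun x hx => by
    rw [← Real.rpow_natCast, ← Real.rpow_mul (by linarith), ← Real.rpow_add (by linarith), hts]
    apply le_of_eq
    congr 1
    push_cast
    ring


theorem coeFn_energyFn {s t : ℝ} (φ : ℝ → ℝ) (hφ : Measurable φ)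
    (hb : ∀ x : ℝ, 0 ≤ x → φ x ^ 2 * (x + 1) ^ t ≤ (x + 1) ^ s) (Ψ : B.Fock h s) :
    ⇑(B.energyFn φ hφ hb Ψ : B.Fock h t).1 =ᵐ[B.configMeasure]
      fun γ => (φ (B.energy γ) : ℂ) • Ψ.1 γ :=
  B.coeFn_mkFock _ _ _ _ _ _ _ _ Ψ

theorem incl_injective {s t : ℝ} (hts : t ≤ s) :
    Function.Injective (B.incl hts : B.Fock h s →L[ℂ] B.Fock h t) := by
  have key : ∀ Ψ : B.Fock h s, ⇑(B.incl hts Ψ : B.Fock h t).1 =ᵐ[B.configMeasure] Ψ.1 := fun Ψ =>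
    (B.coeFn_energyFn _ _ _ Ψ).trans (ae_of_all _ fun γ => by simp)
  intro Ψ Φ hΨΦ
  refine Subtype.ext (Lp.ext ((B.ae_fockMeasure_iff s).2 ?_))
  exact (key Ψ).symm.trans (hΨΦ ▸ key Φ)

theorem numPow_numPow {r r' : ℝ} (hr : r' + r = 0) {s t : ℝ} (hts : t = s - 2 * r)
    (hst : s = t - 2 * r') (Ψ : B.Fock h s) :
    B.numPow r' hst (B.numPow r hts Ψ) = Ψ := by
  refine Subtype.ext (Lp.ext ((B.ae_fockMeasure_iff s).2 ?_))
  refine (B.coeFn_energyFn _ _ _ (B.numPow r hts Ψ)).trans ?_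
  have h1 : ⇑(B.numPow r hts Ψ).1 =ᵐ[B.configMeasure]
      fun γ => (((B.energy γ + 1) ^ r : ℝ) : ℂ) • Ψ.1 γ := B.coeFn_energyFn _ _ _ Ψ
  refine h1.mono fun γ hγ => ?_
  have h0 := B.energy_nonneg γ
  simp only [hγ, smul_smul, ← Complex.ofReal_mul]
  rw [← Real.rpow_add (by linarith), hr]
  simp

/-- The duality pairing `(Ψ, Φ) = ⟨(dΓ(ω) + 1)^(-1/2) Ψ, (dΓ(ω) + 1)^(1/2) Φ⟩` between
`h ⊗ F_{-1}` and `h ⊗ F_1`. -/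
def pairing (Ψ : B.Fock h (-1)) (Φ : B.Fock h 1) : ℂ :=
  inner ℂ (B.numPow (-(1 / 2)) (by norm_num) Ψ : B.Fock h 0)
    (B.numPow (1 / 2) (by norm_num) Φ : B.Fock h 0)

variable {he hg : Type*} [NormedAddCommGroup he] [InnerProductSpace ℂ he] [CompleteSpace he]
  [NormedAddCommGroup hg] [InnerProductSpace ℂ hg] [CompleteSpace hg]

/-- The adjoint `h_e ⊗ F → h_g ⊗ F_{-1}` of a bounded operator `A : h_g ⊗ F_1 → h_e ⊗ F` with
respect to the duality pairing between `F_{-1}` and `F_1`; see `pairing_pairingAdjoint`. -/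
def pairingAdjoint (A : B.Fock hg 1 →L[ℂ] B.Fock he 0) : B.Fock he 0 →L[ℂ] B.Fock hg (-1) :=
  B.numPow (1 / 2) (by norm_num) ∘L
    (ContinuousLinearMap.adjoint
      (A ∘L (B.numPow (-(1 / 2)) (by norm_num) : B.Fock hg 0 →L[ℂ] B.Fock hg 1)))

theorem pairing_pairingAdjoint (A : B.Fock hg 1 →L[ℂ] B.Fock he 0) (Ψ : B.Fock he 0)
    (Φ : B.Fock hg 1) : B.pairing (B.pairingAdjoint A Ψ) Φ = inner ℂ Ψ (A Φ) := by
  rw [pairing, pairingAdjoint, ContinuousLinearMap.comp_apply, numPow_numPow _ (by norm_num),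
    ContinuousLinearMap.adjoint_inner_left, ContinuousLinearMap.comp_apply,
    numPow_numPow _ (by norm_num)]

/-- The free operator `E ⊗ I + I ⊗ dΓ(ω)`, as a bounded map `h ⊗ F_s → h ⊗ F_t`, `t ≤ s - 2`.
As a self-adjoint operator on `h ⊗ F` it is the case `s = 2`, `t = 0`, with domain
`h ⊗ F_2 = h ⊗ D(dΓ(ω))`. -/
def free (E : h →L[ℂ] h) {s t : ℝ} (hts : t + 2 ≤ s) : B.Fock h s →L[ℂ] B.Fock h t :=
  B.atomOp t E ∘L B.incl (by linarith) + B.dΓ hts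

/-- `E ⊗ I + I ⊗ dΓ(ω) - z : h ⊗ F_1 → h ⊗ F_{-1}`. -/
def freeSub (E : h →L[ℂ] h) (z : ℂ) : B.Fock h 1 →L[ℂ] B.Fock h (-1) :=
  B.free E (by norm_num) - z • (B.incl (by norm_num) : B.Fock h 1 →L[ℂ] B.Fock h (-1))

/-- The resolvent `(E ⊗ I + I ⊗ dΓ(ω) - z)⁻¹ : h ⊗ F_{-1} → h ⊗ F_1` (zero if the inverse does not
exist). -/
def freeResolvent (E : h →L[ℂ] h) (z : ℂ) : B.Fock h (-1) →L[ℂ] B.Fock h 1 :=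
  (B.freeSub E z).inverse

variable {r : ℕ}

/-- `A_f = ∑ⱼ Σⱼ⁺ ⊗ a(fⱼ) : h_g ⊗ F_1 → h_e ⊗ F`. -/
def coupling (S : Fin r → hg →L[ℂ] he) (f : Fin r → B.HScale (-1)) :
    B.Fock hg 1 →L[ℂ] B.Fock he 0 :=
  ∑ j, B.atomOp 0 (S j) ∘L B.annihilation (f j)

/-- `A_f† : h_e ⊗ F → h_g ⊗ F_{-1}`. -/
def couplingDag (S : Fin r → hg →L[ℂ] he) (f : Fin r → B.HScale (-1)) :
    B.Fock he 0 →L[ℂ] B.Fock hg (-1) :=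
  B.pairingAdjoint (B.coupling S f)

/-- `S_f(z) = A_f (h_g - z)⁻¹ A_f†`, a bounded operator on `h_e ⊗ F`. -/
def selfEnergy (Eg : hg →L[ℂ] hg) (S : Fin r → hg →L[ℂ] he) (f : Fin r → B.HScale (-1)) (z : ℂ) :
    B.Fock he 0 →L[ℂ] B.Fock he 0 :=
  B.coupling S f ∘L B.freeResolvent Eg z ∘L B.couplingDag S f

/-- The operator `G_f(z) = h_e - z - λ² S_f(z)`, with domain `D(h_e)`, the space `F_2` tensored
with the excited sector. Its inverse is the propagator. -/
def propagatorInv (Ee : he →L[ℂ] he) (Eg : hg →L[ℂ] hg) (S : Fin r → hg →L[ℂ] he) (lam : ℝ)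
    (f : Fin r → B.HScale (-1)) (z : ℂ) : B.Fock he 2 →L[ℂ] B.Fock he 0 :=
  B.free Ee (by norm_num) - z • (B.incl (by norm_num) : B.Fock he 2 →L[ℂ] B.Fock he 0)
    - (lam : ℂ) ^ 2 • (B.selfEnergy Eg S f z ∘L
      (B.incl (by norm_num) : B.Fock he 2 →L[ℂ] B.Fock he 0))

/-- The Hilbert space `(h_e ⊗ F) ⊕ (h_g ⊗ F)`. -/
abbrev TotalSpace (he hg : Type*) [NormedAddCommGroup he] [InnerProductSpace ℂ he]
    [NormedAddCommGroup hg] [InnerProductSpace ℂ hg] : Type _ :=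
  WithLp 2 (B.Fock he 0 × B.Fock hg 0)

end BosonField

/-- The (unbounded) operator with domain `J(V)` and action `J v ↦ T v`, for `J` injective. -/
def LinearPMap.ofParam {V E F : Type*} [AddCommGroup V] [Module ℂ V] [AddCommGroup E] [Module ℂ E]
    [AddCommGroup F] [Module ℂ F] (J : V →ₗ[ℂ] E) (hJ : Function.Injective J) (T : V →ₗ[ℂ] F) :
    E →ₗ.[ℂ] F where
  domain := LinearMap.range J
  toFun := T ∘ₗ (LinearEquiv.ofInjective J hJ).symm.toLinearMap

theorem LinearPMap.ofParam_apply {V E F : Type*} [AddCommGroup V] [Module ℂ V] [AddCommGroup E]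
    [Module ℂ E] [AddCommGroup F] [Module ℂ F] (J : V →ₗ[ℂ] E) (hJ : Function.Injective J)
    (T : V →ₗ[ℂ] F) (v : V) : LinearPMap.ofParam J hJ T ⟨J v, LinearMap.mem_range_self J v⟩ = T v := by
  have : (LinearEquiv.ofInjective J hJ).symm ⟨J v, LinearMap.mem_range_self J v⟩ = v :=
    (LinearEquiv.ofInjective J hJ).symm_apply_apply v
  simp [LinearPMap.ofParam, this]

/-- The off-diagonal operator `(Ψ₁, Ψ₂) ↦ (A Ψ₂, C Ψ₁)` with domain `D(C) ⊕ D(A)`. -/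
def LinearPMap.offDiag {E F : Type*} [NormedAddCommGroup E] [NormedSpace ℂ E]
    [NormedAddCommGroup F] [NormedSpace ℂ F] (A : F →ₗ.[ℂ] E) (C : E →ₗ.[ℂ] F) :
    WithLp 2 (E × F) →ₗ.[ℂ] WithLp 2 (E × F) where
  domain := C.domain.comap (WithLp.fstₗ 2 ℂ E F) ⊓ A.domain.comap (WithLp.sndₗ 2 ℂ E F)
  toFun :=
    { toFun := fun Ψ => WithLp.toLp 2 (A ⟨Ψ.1.snd, Ψ.2.2⟩, C ⟨Ψ.1.fst, Ψ.2.1⟩)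
      map_add' := fun Ψ Φ => by
        rw [← WithLp.toLp_add, Prod.mk_add_mk, ← LinearPMap.map_add, ← LinearPMap.map_add]
        rfl
      map_smul' := fun c Ψ => by
        rw [RingHom.id_apply, ← WithLp.toLp_smul, Prod.smul_mk, ← LinearPMap.map_smul,
          ← LinearPMap.map_smul]
        rfl }

namespace BosonField

variable {X : Type*} [MeasurableSpace X] (B : BosonField X)
variable {he hg : Type*} [NormedAddCommGroup he] [InnerProductSpace ℂ he] [CompleteSpace he]
  [NormedAddCommGroup hg] [InnerProductSpace ℂ hg] [CompleteSpace hg] {r : ℕ}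

/-- `(Φ_e, Φ_g) ↦ (Φ_e, Φ_g - λ (h_g + 1)⁻¹ A_f† Φ_e)` for `Φ_e ∈ D(h_e)`, `Φ_g ∈ D(h_g)`. -/
def singularState (Eg : hg →L[ℂ] hg) (S : Fin r → hg →L[ℂ] he) (lam : ℝ)
    (f : Fin r → B.HScale (-1)) : B.Fock he 2 × B.Fock hg 2 →ₗ[ℂ] B.TotalSpace he hg where
  toFun Φ := WithLp.toLp 2
    (B.incl (by norm_num) Φ.1,
      B.incl (by norm_num) Φ.2 - (lam : ℂ) • B.incl (by norm_num)
        (B.freeResolvent Eg (-1) (B.couplingDag S f (B.incl (by norm_num) Φ.1))))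
  map_add' Φ Φ' := by
    rw [← WithLp.toLp_add]
    simp only [Prod.fst_add, Prod.snd_add, map_add, smul_add, Prod.mk_add_mk]
    congr 2
    abel
  map_smul' c Φ := by
    rw [← WithLp.toLp_smul]
    simp only [Prod.smul_fst, Prod.smul_snd, map_smul, RingHom.id_apply, Prod.smul_mk, smul_sub,
      smul_comm c]

theorem singularState_injective (Eg : hg →L[ℂ] hg) (S : Fin r → hg →L[ℂ] he) (lam : ℝ)
    (f : Fin r → B.HScale (-1)) : Function.Injective (B.singularState Eg S lam f) := by
  rintro ⟨Φ1, Φ2⟩ ⟨Φ1', Φ2'⟩ hΦ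
  have h1 := (Prod.ext_iff.1 ((WithLp.toLp_injective 2) hΦ))
  have h2 := B.incl_injective _ h1.1
  simp only at h2 h1
  subst h2
  have h3 := B.incl_injective _ (sub_left_injective h1.2)
  rw [h3]

/-- The action of the singular Hamiltonian in terms of `(Φ_e, Φ_g)`:
`((h_e - λ² S_f(-1)) Φ_e + λ A_f Φ_g, h_g Φ_g + λ (h_g + 1)⁻¹ A_f† Φ_e)`. -/
def singularAction (Ee : he →L[ℂ] he) (Eg : hg →L[ℂ] hg) (S : Fin r → hg →L[ℂ] he) (lam : ℝ)
    (f : Fin r → B.HScale (-1)) : B.Fock he 2 × B.Fock hg 2 →ₗ[ℂ] B.TotalSpace he hg where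
  toFun Φ := WithLp.toLp 2
    (B.free Ee (by norm_num) Φ.1
        - (lam : ℂ) ^ 2 • B.selfEnergy Eg S f (-1) (B.incl (by norm_num) Φ.1)
        + (lam : ℂ) • B.coupling S f (B.incl (by norm_num) Φ.2),
      B.free Eg (by norm_num) Φ.2 + (lam : ℂ) • B.incl (by norm_num)
        (B.freeResolvent Eg (-1) (B.couplingDag S f (B.incl (by norm_num) Φ.1))))
  map_add' Φ Φ' := by
    rw [← WithLp.toLp_add]
    simp only [Prod.fst_add, Prod.snd_add, map_add, smul_add, Prod.mk_add_mk]
    congr 2 <;> abel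
  map_smul' c Φ := by
    rw [← WithLp.toLp_smul]
    simp only [Prod.smul_fst, Prod.smul_snd, map_smul, RingHom.id_apply, Prod.smul_mk, smul_sub,
      smul_add, smul_comm c]

/-- The singular Hamiltonian `H_f`, `f₁, …, f_r ∈ H_{-1}`. -/
def singularHamiltonian (Ee : he →L[ℂ] he) (Eg : hg →L[ℂ] hg) (S : Fin r → hg →L[ℂ] he) (lam : ℝ)
    (f : Fin r → B.HScale (-1)) : B.TotalSpace he hg →ₗ.[ℂ] B.TotalSpace he hg :=
  LinearPMap.ofParam (B.singularState Eg S lam f) (B.singularState_injective Eg S lam f)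
    (B.singularAction Ee Eg S lam f)

/-- The explicit expression for the resolvent: `(χ, (h_g - z)⁻¹ Ψ_g - λ (h_g - z)⁻¹ A_f† χ)`, where
`χ = G_f(z)⁻¹ (Ψ_e - λ A_f (h_g - z)⁻¹ Ψ_g)`. -/
def resolventFormula (Ee : he →L[ℂ] he) (Eg : hg →L[ℂ] hg) (S : Fin r → hg →L[ℂ] he) (lam : ℝ)
    (f : Fin r → B.HScale (-1)) (z : ℂ) (Ψe : B.Fock he 0) (Ψg : B.Fock hg 0) :
    B.TotalSpace he hg :=
  let Rg : B.Fock hg 1 := B.freeResolvent Eg z (B.incl (by norm_num) Ψg)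
  let χ : B.Fock he 0 := B.incl (by norm_num)
    ((B.propagatorInv Ee Eg S lam f z).inverse (Ψe - (lam : ℂ) • B.coupling S f Rg))
  WithLp.toLp 2 (χ, B.incl (by norm_num) Rg -
    (lam : ℂ) • B.incl (by norm_num) (B.freeResolvent Eg z (B.couplingDag S f χ)))

/-- The decoupled Hamiltonian `H_0 = h_e ⊕ h_g` with domain `(h_e ⊗ D(dΓ(ω))) ⊕ (h_g ⊗ D(dΓ(ω)))`. -/
def freeHamiltonian (Ee : he →L[ℂ] he) (Eg : hg →L[ℂ] hg) :
    B.TotalSpace he hg →ₗ.[ℂ] B.TotalSpace he hg :=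
  LinearPMap.ofParam
    ((WithLp.linearEquiv 2 ℂ (B.Fock he 0 × B.Fock hg 0)).symm.toLinearMap ∘ₗ
      LinearMap.prodMap (B.incl (s := 2) (t := 0) (by norm_num)).toLinearMap
        (B.incl (s := 2) (t := 0) (by norm_num)).toLinearMap)
    ((WithLp.linearEquiv 2 ℂ (B.Fock he 0 × B.Fock hg 0)).symm.injective.comp
      (Function.Injective.prodMap (B.incl_injective (s := 2) (t := 0) (by norm_num))
        (B.incl_injective (s := 2) (t := 0) (by norm_num))))
    ((WithLp.linearEquiv 2 ℂ (B.Fock he 0 × B.Fock hg 0)).symm.toLinearMap ∘ₗ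
      LinearMap.prodMap (B.free Ee (s := 2) (t := 0) (by norm_num)).toLinearMap
        (B.free Eg (s := 2) (t := 0) (by norm_num)).toLinearMap)

/-- `a(f)` as a densely defined operator on `h ⊗ F`, with domain `h ⊗ F_1`. -/
def annihilationOp (h : Type*) [NormedAddCommGroup h] [InnerProductSpace ℂ h]
    (f : B.HScale (-1)) : B.Fock h 0 →ₗ.[ℂ] B.Fock h 0 :=
  LinearPMap.ofParam (B.incl (s := 1) (t := 0) (by norm_num)).toLinearMap (B.incl_injective _)
    (B.annihilation f).toLinearMap

/-- The standard creation operator `a†(f) = a(f)*` on `h ⊗ F`, the Hilbert space adjoint of the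
unbounded operator `a(f)`. -/
def creationOp (h : Type*) [NormedAddCommGroup h] [InnerProductSpace ℂ h] [CompleteSpace h]
    (f : B.HScale (-1)) : B.Fock h 0 →ₗ.[ℂ] B.Fock h 0 :=
  (B.annihilationOp h f).adjoint

/-- `Σ⁺ ⊗ a(f) + Σ⁻ ⊗ a†(f)` with `Σ⁻ = (Σ⁺)†`. -/
def interaction (S : hg →L[ℂ] he) (f : B.HScale (-1)) :
    B.TotalSpace he hg →ₗ.[ℂ] B.TotalSpace he hg :=
  LinearPMap.offDiag ((B.atomOp 0 S).toLinearMap.compPMap (B.annihilationOp hg f))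
    ((B.atomOp 0 (ContinuousLinearMap.adjoint S)).toLinearMap.compPMap (B.creationOp he f))

/-- The regular Hamiltonian `H_0 + λ ∑ⱼ (Σⱼ⁺ ⊗ a(fⱼ) + Σⱼ⁻ ⊗ a†(fⱼ))`, as a sum of unbounded
operators (on the intersection of their domains). It is meant for `f₁, …, f_r ∈ H`. -/
def regularHamiltonian (Ee : he →L[ℂ] he) (Eg : hg →L[ℂ] hg) (S : Fin r → hg →L[ℂ] he) (lam : ℝ)
    (f : Fin r → B.HScale (-1)) : B.TotalSpace he hg →ₗ.[ℂ] B.TotalSpace he hg :=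
  B.freeHamiltonian Ee Eg + (lam : ℂ) • ∑ j, B.interaction (S j) (f j)

end BosonField

/-- `R = (H - z)⁻¹`: a bounded operator which is a two-sided inverse of `H - z : D(H) → E`. -/
def IsResolventAt {E : Type*} [NormedAddCommGroup E] [NormedSpace ℂ E] (H : E →ₗ.[ℂ] E) (z : ℂ)
    (R : E →L[ℂ] E) : Prop :=
  (∀ Φ : E, ∃ hR : R Φ ∈ H.domain, H ⟨R Φ, hR⟩ - z • R Φ = Φ) ∧
    ∀ Ψ : H.domain, R (H Ψ - z • (Ψ : E)) = Ψ

/-- Norm resolvent convergence: `(Hᵢ - z)⁻¹ → (H - z)⁻¹` in operator norm for all nonreal `z`. -/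
def NormResolventTendsto {E : Type*} [NormedAddCommGroup E] [NormedSpace ℂ E]
    (Hs : ℕ → E →ₗ.[ℂ] E) (H : E →ₗ.[ℂ] E) : Prop :=
  ∀ z : ℂ, z.im ≠ 0 → ∃ (Rs : ℕ → E →L[ℂ] E) (R : E →L[ℂ] E),
    (∀ i, IsResolventAt (Hs i) z (Rs i)) ∧ IsResolventAt H z R ∧ Tendsto Rs atTop (𝓝 R)

end

/-!
# The singular Hamiltonian: self-adjointness, resolvent and approximation

The scale `h ⊗ F_s` consists of functions of the boson configuration, and the free operators act on
the fibre over a configuration of energy `x` as the matrix `E + x`. Hence `E + x - z` can be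
inverted fibre by fibre. For `z = -1` and for nonreal `z` there is a complex number `α` with
`Re (α (y - z)) = y + 1` for all real `y`, so positivity of `E` gives the bound `|α| / (x + 1)` for
the inverse of the fibre. This makes `h_g - z : F_{s+2} → F_s` invertible for every `s`
(`isInvertible_free_sub`), which gives both the resolvent `F_{-1} → F_1` and the regularity statement
that an `η ∈ F_1` with `h_g η ∈ F_0` lies in `F_2` (`exists_incl_eq_of_free_eq_incl`).

The main point is `mem_graph_singularHamiltonian_iff`: after the substitution
`η = Φ_g - λ (h_g + 1)⁻¹ A_f† Φ_e`, the singular Hamiltonian is simply the formal matrix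
`(h_e, λ A_f; λ A_f†, h_g)` acting from `F_2 × F_1` to `F_0 × F_{-1}`, restricted to those pairs whose
image lies in `F_0 × F_0`. All claims are read off from this description.

* The operator is symmetric, as `A_f†` is the adjoint of `A_f` for the pairing
  (`isFormalAdjoint_singularHamiltonian`).
* Solving the block system by elimination of `η` gives the resolvent formula
  (`mem_graph_iff_eq_resolventOp`), once the Schur complement `G_f(z) = h_e - z - λ² S_f(z)` is known
  to be invertible. With `Φ = (h_g - z)⁻¹ A_f† χ` one has
  `Im ⟨χ, G_f(z) χ⟩ = - Im z (‖χ‖² + λ² ‖Φ‖²)`, so `G_f(z)` is bounded below; its formal adjoint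
  `G_f(z̄)` is too, and this suffices (`isInvertible_propagatorInv`). A symmetric operator with
  `H - z` and `H - z̄` onto is self-adjoint.
* If `f ∈ L²`, the positive mass bounds the particle number by the energy, so `a(f)` extends to a
  bounded operator `F_0 → F_{-1}`. Dually `A_f†` maps `F_1` to `F_0`, where it is given by the
  creation operators. The condition `h_g η + λ A_f† χ ∈ F_0` then says `η ∈ F_2`, and the regular
  Hamiltonian results.
* The coupling `A_f` depends continuously on `f ∈ H_{-1}` in operator norm, hence so does the explicit
  resolvent (`continuous_resolventOp`); and `L²` is dense in `H_{-1}` by cutting off large `ω`.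
-/

noncomputable section

namespace BosonField

variable {X : Type*} [MeasurableSpace X] {B : BosonField X}
variable {h h' : Type*} [NormedAddCommGroup h] [InnerProductSpace ℂ h]
  [NormedAddCommGroup h'] [InnerProductSpace ℂ h']

/-! ### Elements of the Fock scale as functions -/

theorem fock_ext {s : ℝ} {Ψ Φ : B.Fock h s} (H : ⇑Ψ.1 =ᵐ[B.configMeasure] Φ.1) : Ψ = Φ :=
  Subtype.ext (Lp.ext ((B.ae_fockMeasure_iff s).2 H))

theorem coeFn_fock_add {s : ℝ} (Ψ Φ : B.Fock h s) :
    ⇑(Ψ + Φ).1 =ᵐ[B.configMeasure] fun γ => Ψ.1 γ + Φ.1 γ :=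
  (B.ae_fockMeasure_iff s).1 (Lp.coeFn_add Ψ.1 Φ.1)

theorem coeFn_fock_sub {s : ℝ} (Ψ Φ : B.Fock h s) :
    ⇑(Ψ - Φ).1 =ᵐ[B.configMeasure] fun γ => Ψ.1 γ - Φ.1 γ :=
  (B.ae_fockMeasure_iff s).1 (Lp.coeFn_sub Ψ.1 Φ.1)

theorem coeFn_fock_smul {s : ℝ} (c : ℂ) (Ψ : B.Fock h s) :
    ⇑(c • Ψ).1 =ᵐ[B.configMeasure] fun γ => c • Ψ.1 γ :=
  (B.ae_fockMeasure_iff s).1 (Lp.coeFn_smul c Ψ.1)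

theorem coeFn_incl {s t : ℝ} (hts : t ≤ s) (Ψ : B.Fock h s) :
    ⇑(B.incl hts Ψ).1 =ᵐ[B.configMeasure] Ψ.1 :=
  (B.coeFn_energyFn _ _ _ Ψ).trans (ae_of_all _ fun γ => by simp)

theorem coeFn_numPow (r : ℝ) {s t : ℝ} (hts : t = s - 2 * r) (Ψ : B.Fock h s) :
    ⇑(B.numPow r hts Ψ).1 =ᵐ[B.configMeasure]
      fun γ => (((B.energy γ + 1) ^ r : ℝ) : ℂ) • Ψ.1 γ :=
  B.coeFn_energyFn _ _ _ Ψ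

theorem coeFn_atomOp (s : ℝ) (L : h →L[ℂ] h') (Ψ : B.Fock h s) :
    ⇑(B.atomOp s L Ψ).1 =ᵐ[B.configMeasure] fun γ => L (Ψ.1 γ) :=
  B.coeFn_mkFock _ _ _ _ _ _ _ _ Ψ

theorem coeFn_annihilation (f : B.HScale (-1)) (Ψ : B.Fock h 1) :
    ⇑(B.annihilation f Ψ).1 =ᵐ[B.configMeasure] B.annihilationFun f Ψ.1 :=
  B.coeFn_mkFock _ _ _ _ _ _ _ _ Ψ

theorem coeFn_free (E : h →L[ℂ] h) {s t : ℝ} (hts : t + 2 ≤ s) (Ψ : B.Fock h s) :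
    ⇑(B.free E hts Ψ).1 =ᵐ[B.configMeasure]
      fun γ => E (Ψ.1 γ) + (B.energy γ : ℂ) • Ψ.1 γ := by
  have h1 : ⇑(B.dΓ hts Ψ).1 =ᵐ[B.configMeasure] fun γ => (B.energy γ : ℂ) • Ψ.1 γ :=
    B.coeFn_energyFn _ _ _ Ψ
  have hi : t ≤ s := by linarith
  filter_upwards [coeFn_fock_add (B.atomOp t E (B.incl hi Ψ)) (B.dΓ hts Ψ), h1,
    coeFn_atomOp t E (B.incl hi Ψ), coeFn_incl hi Ψ] with γ a1 a2 a3 a4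
  rw [free, add_apply, ContinuousLinearMap.comp_apply, a1, a2, a3, a4]

theorem incl_incl {s t u : ℝ} (h1 : t ≤ s) (h2 : u ≤ t) (Ψ : B.Fock h s) :
    B.incl h2 (B.incl h1 Ψ) = B.incl (h2.trans h1) Ψ :=
  fock_ext <| ((coeFn_incl h2 _).trans (coeFn_incl h1 Ψ)).trans (coeFn_incl _ Ψ).symm

theorem free_incl (E : h →L[ℂ] h) {s t u : ℝ} (h1 : t ≤ s) (h2 : u + 2 ≤ t) (Ψ : B.Fock h s) :
    B.free E h2 (B.incl h1 Ψ) = B.free E (h2.trans h1) Ψ := by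
  refine fock_ext ?_
  filter_upwards [coeFn_free E h2 (B.incl h1 Ψ), coeFn_free E (h2.trans h1) Ψ, coeFn_incl h1 Ψ]
    with γ a1 a2 a3
  rw [a1, a2, a3]

theorem incl_free (E : h →L[ℂ] h) {s t u : ℝ} (h1 : t + 2 ≤ s) (h2 : u ≤ t) (Ψ : B.Fock h s) :
    B.incl h2 (B.free E h1 Ψ) = B.free E (by linarith) Ψ := by
  refine fock_ext ?_
  filter_upwards [coeFn_free E h1 Ψ, coeFn_free (t := u) E (by linarith) Ψ,
    coeFn_incl h2 (B.free E h1 Ψ)] with γ a1 a2 a3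
  rw [a3, a1, a2]

theorem incl_atomOp {s t : ℝ} (L : h →L[ℂ] h') (h1 : t ≤ s) (Ψ : B.Fock h s) :
    B.incl h1 (B.atomOp s L Ψ) = B.atomOp t L (B.incl h1 Ψ) := by
  refine fock_ext ?_
  filter_upwards [coeFn_atomOp s L Ψ, coeFn_incl h1 (B.atomOp s L Ψ),
    coeFn_atomOp t L (B.incl h1 Ψ), coeFn_incl h1 Ψ] with γ a1 a2 a3 a4
  rw [a2, a1, a3, a4]

/-! ### Inner products and the duality pairing as integrals -/

theorem fockMeasure_zero : B.fockMeasure 0 = B.configMeasure := by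
  simp [fockMeasure]

theorem inner_fock_zero (Ψ Φ : B.Fock h 0) :
    inner ℂ Ψ Φ = ∫ γ, inner ℂ (Ψ.1 γ) (Φ.1 γ) ∂B.configMeasure := by
  rw [← fockMeasure_zero, Submodule.coe_inner, L2.inner_def]

theorem pairing_eq_integral (Ψ : B.Fock h (-1)) (Φ : B.Fock h 1) :
    B.pairing Ψ Φ = ∫ γ, inner ℂ (Ψ.1 γ) (Φ.1 γ) ∂B.configMeasure := by
  rw [pairing, inner_fock_zero]
  refine integral_congr_ae ?_
  filter_upwards [coeFn_numPow (t := 0) (-(1 / 2)) (by norm_num) Ψ,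
    coeFn_numPow (t := 0) (1 / 2) (by norm_num) Φ] with γ a1 a2
  have h0 := B.energy_nonneg γ
  rw [a1, a2, inner_smul_left, inner_smul_right, ← mul_assoc, Complex.conj_ofReal,
    ← Complex.ofReal_mul, ← Real.rpow_add (by linarith)]
  simp

theorem pairing_incl_left (Ψ : B.Fock h 0) (Φ : B.Fock h 1) :
    B.pairing (B.incl (by norm_num) Ψ) Φ = inner ℂ Ψ (B.incl (by norm_num) Φ) := by
  rw [pairing_eq_integral, inner_fock_zero]
  refine integral_congr_ae ?_
  filter_upwards [coeFn_incl (t := -1) (by norm_num) Ψ, coeFn_incl (t := 0) (by norm_num) Φ]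
    with γ a1 a2
  rw [a1, a2]

theorem pairing_incl_left' (Ψ Φ : B.Fock h 1) :
    B.pairing (B.incl (by norm_num) Ψ) Φ
      = inner ℂ (B.incl (t := 0) (by norm_num) Ψ) (B.incl (t := 0) (by norm_num) Φ) := by
  rw [← pairing_incl_left, incl_incl]

theorem inner_fock_smul_left (c : ℂ) (Ψ Φ : B.Fock h 0) :
    inner ℂ (c • Ψ) Φ = conj c * inner ℂ Ψ Φ :=
  inner_smul_left (𝕜 := ℂ) (E := B.Fock h 0) Ψ Φ c

theorem inner_fock_smul_right (c : ℂ) (Ψ Φ : B.Fock h 0) :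
    inner ℂ Ψ (c • Φ) = c * inner ℂ Ψ Φ :=
  inner_smul_right (𝕜 := ℂ) (E := B.Fock h 0) Ψ Φ c

theorem inner_fock_conj_symm (Ψ Φ : B.Fock h 0) : conj (inner ℂ Ψ Φ) = inner ℂ Φ Ψ :=
  inner_conj_symm (𝕜 := ℂ) (E := B.Fock h 0) Φ Ψ

theorem inner_fock_self (Ψ : B.Fock h 0) : inner ℂ Ψ Ψ = ((‖Ψ‖ ^ 2 : ℝ) : ℂ) :=
  (inner_self_eq_norm_sq_to_K (𝕜 := ℂ) (E := B.Fock h 0) Ψ).trans (by simp)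

theorem norm_inner_fock_le (Ψ Φ : B.Fock h 0) : ‖inner ℂ Ψ Φ‖ ≤ ‖Ψ‖ * ‖Φ‖ :=
  norm_inner_le_norm (𝕜 := ℂ) (E := B.Fock h 0) Ψ Φ

theorem pairing_add_left (Ψ Ψ' : B.Fock h (-1)) (Φ : B.Fock h 1) :
    B.pairing (Ψ + Ψ') Φ = B.pairing Ψ Φ + B.pairing Ψ' Φ := by
  simp only [pairing, map_add, inner_add_left]

theorem pairing_sub_left (Ψ Ψ' : B.Fock h (-1)) (Φ : B.Fock h 1) :
    B.pairing (Ψ - Ψ') Φ = B.pairing Ψ Φ - B.pairing Ψ' Φ := by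
  simp only [pairing, map_sub, inner_sub_left]

theorem pairing_smul_left (c : ℂ) (Ψ : B.Fock h (-1)) (Φ : B.Fock h 1) :
    B.pairing (c • Ψ) Φ = conj c * B.pairing Ψ Φ := by
  rw [pairing, map_smul, inner_fock_smul_left, pairing]

/-- The pairing separates the points of `h ⊗ F_{-1}`. -/
theorem eq_of_pairing_eq {Ψ Ψ' : B.Fock h (-1)}
    (H : ∀ Φ : B.Fock h 1, B.pairing Ψ Φ = B.pairing Ψ' Φ) : Ψ = Ψ' := by
  have h1 : B.numPow (t := 0) (-(1 / 2)) (by norm_num) Ψ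
      = B.numPow (t := 0) (-(1 / 2)) (by norm_num) Ψ' := by
    refine ext_inner_right ℂ fun Φ => ?_
    have := H (B.numPow (-(1 / 2)) (by norm_num) Φ)
    rwa [pairing, pairing, numPow_numPow _ (by norm_num)] at this
  have h2 := congrArg (B.numPow (t := -1) (1 / 2) (by norm_num)) h1
  rwa [numPow_numPow _ (by norm_num), numPow_numPow _ (by norm_num)] at h2

/-- `h_s` is a symmetric form on `h ⊗ F_1`. -/
theorem pairing_free_symm {E : h →L[ℂ] h} (hE : ∀ u v : h, inner ℂ (E u) v = inner ℂ u (E v))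
    (Ψ Φ : B.Fock h 1) :
    B.pairing (B.free E (by norm_num) Ψ) Φ = conj (B.pairing (B.free E (by norm_num) Φ) Ψ) := by
  rw [pairing_eq_integral, pairing_eq_integral, ← integral_conj]
  refine integral_congr_ae ?_
  filter_upwards [coeFn_free (t := -1) E (by norm_num) Ψ, coeFn_free (t := -1) E (by norm_num) Φ]
    with γ a1 a2
  rw [a1, a2, inner_conj_symm, inner_add_left, inner_add_right, hE, inner_smul_left,
    inner_smul_right, Complex.conj_ofReal]

/-- `h_s` with domain `h ⊗ D(dΓ(ω))` is symmetric. -/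
theorem inner_free_symm {E : h →L[ℂ] h} (hE : ∀ u v : h, inner ℂ (E u) v = inner ℂ u (E v))
    (Ψ Φ : B.Fock h 2) :
    inner ℂ (B.free E (s := 2) (t := 0) (by norm_num) Ψ) (B.incl (t := 0) (by norm_num) Φ)
      = inner ℂ (B.incl (t := 0) (by norm_num) Ψ) (B.free E (s := 2) (t := 0) (by norm_num) Φ) := by
  rw [inner_fock_zero, inner_fock_zero]
  refine integral_congr_ae ?_
  filter_upwards [coeFn_free (t := 0) E (by norm_num) Ψ, coeFn_free (t := 0) E (by norm_num) Φ,
    coeFn_incl (t := 0) (by norm_num) Ψ, coeFn_incl (t := 0) (by norm_num) Φ]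
    with γ a1 a2 a3 a4
  rw [a1, a2, a3, a4, inner_add_left, inner_add_right, hE, inner_smul_left,
    inner_smul_right, Complex.conj_ofReal]

/-! ### The resolvent of the free operator -/

/-- The operator which multiplies by an operator-valued function `M` of the energy, as a bounded
map `h ⊗ F_s → h ⊗ F_t`. -/
def fiberOp {s t : ℝ} (M : ℝ → h →L[ℂ] h) (hM : Continuous M) (C : ℝ≥0)
    (hb : ∀ x : ℝ, 0 ≤ x → ‖M x‖ ^ 2 * (x + 1) ^ t ≤ C ^ 2 * (x + 1) ^ s) :
    B.Fock h s →L[ℂ] B.Fock h t :=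
  B.mkFock (fun Ψ γ => M (B.energy γ) (Ψ γ))
    (fun Ψ => (ContinuousLinearMap.apply ℂ h : h →L[ℂ] _).flip.aestronglyMeasurable_comp₂
      ((hM.stronglyMeasurable.comp_measurable B.measurable_energy).aestronglyMeasurable)
      (Lp.stronglyMeasurable Ψ.1).aestronglyMeasurable)
    C
    (fun Ψ => B.eLpNorm_fock_le <| by
      rw [← lintegral_const_mul' _ _ (by finiteness)]
      refine lintegral_mono fun γ => ?_
      have h0 := B.energy_nonneg γ
      have h1 : ‖M (B.energy γ) (Ψ.1 γ)‖ₑ ≤ ‖M (B.energy γ)‖ₑ * ‖Ψ.1 γ‖ₑ :=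
        (M (B.energy γ)).le_opENorm _
      have h2 : (C : ℝ≥0∞) ^ 2 * ENNReal.ofReal ((B.energy γ + 1) ^ s)
          = ENNReal.ofReal (C ^ 2 * (B.energy γ + 1) ^ s) := by
        rw [ENNReal.ofReal_mul (by positivity), ENNReal.ofReal_pow C.coe_nonneg, ENNReal.ofReal_coe_nnreal]
      rw [← mul_assoc, h2]
      refine le_trans (mul_le_mul_right (pow_le_pow_left' h1 2) _) ?_
      rw [mul_pow, ← mul_assoc]
      gcongr
      rw [← ofReal_norm, ← ENNReal.ofReal_pow (norm_nonneg _),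
        ← ENNReal.ofReal_mul (by positivity), mul_comm]
      exact ENNReal.ofReal_le_ofReal (hb _ h0))
    (fun Ψ σ => (Ψ.2 σ).mono fun γ hγ => by simp only [energy_permute, hγ])
    (fun Ψ Φ hΨ => hΨ.mono fun γ hγ => by simp only [hγ])
    (fun Ψ Φ => ae_of_all _ fun γ => by simp only [Pi.add_apply, map_add])
    (fun c Ψ => ae_of_all _ fun γ => by simp only [Pi.smul_apply, map_smul])

theorem coeFn_fiberOp {s t : ℝ} (M : ℝ → h →L[ℂ] h) (hM : Continuous M) (C : ℝ≥0)
    (hb : ∀ x : ℝ, 0 ≤ x → ‖M x‖ ^ 2 * (x + 1) ^ t ≤ C ^ 2 * (x + 1) ^ s) (Ψ : B.Fock h s) :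
    ⇑(B.fiberOp M hM C hb Ψ : B.Fock h t).1 =ᵐ[B.configMeasure]
      fun γ => M (B.energy γ) (Ψ.1 γ) :=
  B.coeFn_mkFock _ _ _ _ _ _ _ _ Ψ

/-- The spectral parameters which lie off the half-line `[0, ∞)` in the quantitative form needed
for the resolvent: some rotation `α` makes `α (y - z)` have real part `y + 1` for all real `y`. -/
def OffHalfLine (z : ℂ) : Prop := ∃ α : ℂ, ∀ y : ℝ, (α * (y - z)).re = y + 1

theorem offHalfLine_neg_one : OffHalfLine (-1) := ⟨1, fun y => by simp⟩

theorem offHalfLine_of_im_ne_zero {z : ℂ} (hz : z.im ≠ 0) : OffHalfLine z :=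
  -- With `α = 1 + i b` the real part is `y - Re z + b Im z`.
  ⟨⟨1, (z.re + 1) / z.im⟩, fun y => by simp; field_simp; ring⟩

variable {E : h →L[ℂ] h} {z : ℂ}

/-- The fibre `E + |x| - z` of the free operator at energy `x`; the absolute value is immaterial
for the nonnegative energies and makes the fibre invertible for all real `x`. -/
def fiber (E : h →L[ℂ] h) (z : ℂ) (x : ℝ) : h →L[ℂ] h := E + (((|x| : ℝ) : ℂ) - z) • 1

theorem continuous_fiber (E : h →L[ℂ] h) (z : ℂ) : Continuous (fiber E z) := by
  unfold fiber
  fun_prop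

/-- The rotated fibre `α (E + |x| - z)` has real part at least `|x| + 1`. -/
theorem le_norm_fiber [CompleteSpace h] (hE : E.IsPositive) {α : ℂ}
    (hα : ∀ y : ℝ, (α * (y - z)).re = y + 1) (x : ℝ) (v : h) :
    (|x| + 1) * ‖v‖ ≤ ‖α‖ * ‖fiber E z x v‖ := by
  rcases eq_or_ne v 0 with rfl | hv
  · simp
  have hα1 : α.re = 1 := by
    have h0 := hα 0
    have h1 := hα 1
    simp only [Complex.ofReal_zero, Complex.ofReal_one, mul_sub, Complex.sub_re, mul_zero,
      mul_one, Complex.zero_re] at h0 h1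
    linarith
  have hq : 0 ≤ (inner ℂ v (E v)).re := hE.re_inner_nonneg_right v
  have hq' : (inner ℂ v (E v)).im = 0 := by
    have := (RCLike.nonneg_iff.1 (hE.inner_nonneg_right v)).2
    simpa using this
  have key : (inner ℂ v (α • fiber E z x v)).re
      = (inner ℂ v (E v)).re + (|x| + 1) * ‖v‖ ^ 2 := by
    have e1 : inner ℂ v (α • fiber E z x v)
        = α * inner ℂ v (E v) + (α * ((|x| : ℝ) - z)) * ((‖v‖ ^ 2 : ℝ) : ℂ) := by
      simp only [fiber, add_apply, smul_apply, one_apply_eq_self, inner_smul_right,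
        inner_add_right, inner_self_eq_norm_sq_to_K, Complex.coe_algebraMap, Complex.ofReal_pow]
      ring
    rw [e1, Complex.add_re, Complex.mul_re, Complex.re_mul_ofReal, hα, hq', hα1]
    ring
  have h1 : (inner ℂ v (α • fiber E z x v)).re ≤ ‖v‖ * (‖α‖ * ‖fiber E z x v‖) := by
    rw [← norm_smul]
    exact (Complex.re_le_norm _).trans (norm_inner_le_norm _ _)
  have h2 : 0 < ‖v‖ := norm_pos_iff.2 hv
  nlinarith

theorem freeSub_apply (Φ : B.Fock h 1) :
    B.freeSub E z Φ = B.free E (by norm_num) Φ - z • B.incl (by norm_num) Φ := rfl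

theorem pairing_freeSub_symm (hE : E.IsPositive) (Φ Φ' : B.Fock h 1) :
    B.pairing (B.freeSub E (conj z) Φ') Φ = conj (B.pairing (B.freeSub E z Φ) Φ') := by
  rw [freeSub_apply, freeSub_apply, pairing_sub_left, pairing_sub_left, pairing_smul_left,
    pairing_smul_left, pairing_incl_left', pairing_incl_left',
    pairing_free_symm hE.inner_left_eq_inner_right Φ' Φ, map_sub, map_mul, Complex.conj_conj,
    inner_fock_conj_symm]

variable [CompleteSpace h] [FiniteDimensional ℂ h]

theorem isUnit_fiber (hE : E.IsPositive) (hz : OffHalfLine z) (x : ℝ) :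
    IsUnit (fiber E z x) := by
  obtain ⟨α, hα⟩ := hz
  have hinj : Function.Injective (fiber E z x).toLinearMap := by
    refine (injective_iff_map_eq_zero _).2 fun v hv => ?_
    have h1 := le_norm_fiber hE hα x v
    have hv' : fiber E z x v = 0 := hv
    rw [hv', norm_zero, mul_zero] at h1
    have h2 := abs_nonneg x
    exact norm_le_zero_iff.1 (by nlinarith [norm_nonneg v])
  exact ContinuousLinearMap.isUnit_iff_bijective.2
    ⟨hinj, LinearMap.injective_iff_surjective.1 hinj⟩

theorem norm_inverse_fiber_le (hE : E.IsPositive) {α : ℂ}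
    (hα : ∀ y : ℝ, (α * (y - z)).re = y + 1) (x : ℝ) :
    ‖Ring.inverse (fiber E z x)‖ ≤ ‖α‖ / (|x| + 1) := by
  have hx : 0 < |x| + 1 := by positivity
  refine ContinuousLinearMap.opNorm_le_bound _ (by positivity) fun v => ?_
  have h1 := le_norm_fiber hE hα x (Ring.inverse (fiber E z x) v)
  have h2 : fiber E z x (Ring.inverse (fiber E z x) v) = v :=
    DFunLike.congr_fun (Ring.mul_inverse_cancel _ (isUnit_fiber hE ⟨α, hα⟩ x)) v
  rw [h2] at h1
  rw [div_mul_eq_mul_div, le_div_iff₀ hx, mul_comm]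
  exact h1

theorem continuous_inverse_fiber (hE : E.IsPositive) (hz : OffHalfLine z) :
    Continuous fun x => Ring.inverse (fiber E z x) := by
  refine continuous_iff_continuousAt.2 fun x => ?_
  obtain ⟨u, hu⟩ := isUnit_fiber hE hz x
  have := NormedRing.inverse_continuousAt u
  rw [hu] at this
  exact this.comp (continuous_fiber E z).continuousAt

/-- `E ⊗ I + I ⊗ dΓ(ω) - z : h ⊗ F_s → h ⊗ F_{s-2}` has a bounded inverse for every `s`. -/
theorem isInvertible_free_sub (hE : E.IsPositive) (hz : OffHalfLine z) {s t : ℝ}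
    (hts : t + 2 = s) :
    (B.free E hts.le - z • (B.incl (by linarith) : B.Fock h s →L[ℂ] B.Fock h t)).IsInvertible := by
  obtain ⟨α, hα⟩ := hz
  let R : B.Fock h t →L[ℂ] B.Fock h s :=
    B.fiberOp (fun x => Ring.inverse (fiber E z x)) (continuous_inverse_fiber hE ⟨α, hα⟩) ‖α‖₊
      fun x hx => by
      have h1 := norm_inverse_fiber_le hE hα x
      rw [abs_of_nonneg hx] at h1
      have h2 : (x + 1) ^ s = (x + 1) ^ t * (x + 1) ^ 2 := by
        rw [← Real.rpow_two, ← Real.rpow_add (by linarith), hts]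
      calc _ ≤ (‖α‖ / (x + 1)) ^ 2 * (x + 1) ^ s := by gcongr
        _ = _ := by
          rw [h2]
          have : x + 1 ≠ 0 := by linarith
          simp only [coe_nnnorm]
          field_simp
  have hR : ∀ Ψ, ⇑(R Ψ).1 =ᵐ[B.configMeasure]
      fun γ => Ring.inverse (fiber E z (B.energy γ)) (Ψ.1 γ) :=
    B.coeFn_fiberOp _ _ _ _
  have hT : ∀ Ψ : B.Fock h s,
      ⇑((B.free E hts.le - z • (B.incl (by linarith) : B.Fock h s →L[ℂ] B.Fock h t)) Ψ).1
        =ᵐ[B.configMeasure] fun γ => fiber E z (B.energy γ) (Ψ.1 γ) := by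
    intro Ψ
    have hi : t ≤ s := by linarith
    filter_upwards [coeFn_fock_sub (B.free E hts.le Ψ) (z • B.incl hi Ψ),
      coeFn_fock_smul z (B.incl hi Ψ), coeFn_incl hi Ψ, coeFn_free E hts.le Ψ] with γ a1 a2 a3 a4
    rw [sub_apply, smul_apply, a1, a2, a3, a4, fiber, abs_of_nonneg (B.energy_nonneg γ)]
    simp only [add_apply, smul_apply, one_apply_eq_self]
    rw [sub_smul]
    abel
  refine ContinuousLinearMap.IsInvertible.of_inverse (g := R) ?_ ?_
  · ext1 Ψ
    refine fock_ext ?_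
    filter_upwards [hT (R Ψ), hR Ψ] with γ a1 a2
    rw [ContinuousLinearMap.comp_apply, a1, a2]
    exact DFunLike.congr_fun (Ring.mul_inverse_cancel _ (isUnit_fiber hE ⟨α, hα⟩ _)) _
  · ext1 Ψ
    refine fock_ext ?_
    filter_upwards [hR ((B.free E hts.le - z • (B.incl (by linarith) :
      B.Fock h s →L[ℂ] B.Fock h t)) Ψ), hT Ψ] with γ a1 a2
    rw [ContinuousLinearMap.comp_apply, a1, a2]
    exact DFunLike.congr_fun (Ring.inverse_mul_cancel _ (isUnit_fiber hE ⟨α, hα⟩ _)) _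

theorem isInvertible_freeSub (hE : E.IsPositive) (hz : OffHalfLine z) :
    (B.freeSub E z).IsInvertible :=
  isInvertible_free_sub hE hz (by norm_num)

end BosonField

/-! ### Two criteria from abstract operator theory -/

/-- A symmetric operator `H` for which `H - z` and `H - z̄` are onto is self-adjoint; density of
the domain need not be assumed. -/
theorem LinearPMap.isSelfAdjoint_of_surjective {E : Type*} [NormedAddCommGroup E]
    [InnerProductSpace ℂ E] [CompleteSpace E] (H : E →ₗ.[ℂ] E)
    (hsymm : H.IsFormalAdjoint H) (z : ℂ)
    (hz : ∀ Φ : E, ∃ x : H.domain, H x - z • (x : E) = Φ)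
    (hz' : ∀ Φ : E, ∃ x : H.domain, H x - conj z • (x : E) = Φ) : IsSelfAdjoint H := by
  have hsz : ∀ x y : H.domain,
      inner ℂ (H x - conj z • (x : E)) (y : E) = inner ℂ (x : E) (H y - z • (y : E)) := by
    intro x y
    rw [inner_sub_left, inner_sub_right, inner_smul_left, inner_smul_right, hsymm x y,
      Complex.conj_conj]
  -- If `Φ = (H - z̄) x` is orthogonal to the domain, then `x` is orthogonal to the range of `H - z`.
  have hdense : Dense (H.domain : Set E) := by
    rw [Submodule.dense_iff_topologicalClosure_eq_top,
      Submodule.topologicalClosure_eq_top_iff, Submodule.eq_bot_iff]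
    intro Φ hΦ
    obtain ⟨x, rfl⟩ := hz' Φ
    have hx : (x : E) = 0 := by
      obtain ⟨y, hy⟩ := hz x
      have h1 := (Submodule.mem_orthogonal' _ _).1 hΦ y y.2
      rw [hsz, hy] at h1
      exact inner_self_eq_zero.1 h1
    have hx' : x = 0 := Subtype.ext hx
    simp [hx']
  have hle : H ≤ H.adjoint := LinearPMap.IsFormalAdjoint.le_adjoint hdense hsymm
  refine (LinearPMap.isSelfAdjoint_def).2 (LinearPMap.eq_of_le_of_domain_eq hle ?_).symm
  refine le_antisymm hle.1 fun y hy => ?_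
  -- The solution `x` in the domain of `(H - z̄) x = (H† - z̄) y` is shown to be `y`.
  obtain ⟨x, hx⟩ := hz' (H.adjoint ⟨y, hy⟩ - conj z • y)
  obtain ⟨v, hv⟩ := hz (y - x)
  have h1 : inner ℂ (H.adjoint ⟨y, hy⟩ - conj z • y) (v : E) = inner ℂ y (H v - z • (v : E)) := by
    have := H.adjoint_isFormalAdjoint hdense ⟨y, hy⟩ v
    rw [inner_sub_left, inner_sub_right, inner_smul_left, inner_smul_right, this,
      Complex.conj_conj]
  have h2 : inner ℂ (y - x) (y - x : E) = 0 := by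
    rw [inner_sub_left, ← hv, ← h1, ← hsz, hx, sub_self]
  rw [sub_eq_zero.1 (inner_self_eq_zero.1 h2)]
  exact x.2

/-- Invertibility of a bounded perturbation `L - K` of an invertible unbounded operator `L` with
domain `V ⊆ H`, given that `L - K` is bounded below and that its formal adjoint `L' - K†` is
injective. -/
theorem ContinuousLinearMap.isInvertible_sub_of_bounded_below {V H : Type*} [NormedAddCommGroup V]
    [NormedSpace ℂ V] [CompleteSpace V] [NormedAddCommGroup H] [InnerProductSpace ℂ H]
    [CompleteSpace H] {J L L' : V →L[ℂ] H} {K : H →L[ℂ] H} (hL : L.IsInvertible)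
    (hL' : Function.Surjective L') (hadj : ∀ u v, inner ℂ (L' u) (J v) = inner ℂ (J u) (L v))
    {C : ℝ} (hC : ∀ v, ‖J v‖ ≤ C * ‖(L - K ∘L J) v‖)
    (hinj : ∀ u, L' u = adjoint K (J u) → J u = 0) : (L - K ∘L J).IsInvertible := by
  have hbelow : ∀ v, ‖v‖ ≤ ‖L.inverse‖ * (1 + ‖K‖ * C) * ‖(L - K ∘L J) v‖ := by
    intro v
    have h1 : L v = (L - K ∘L J) v + K (J v) := by simp
    calc ‖v‖ = ‖L.inverse (L v)‖ := by rw [hL.inverse_apply_self]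
      _ ≤ ‖L.inverse‖ * ‖L v‖ := L.inverse.le_opNorm _
      _ ≤ ‖L.inverse‖ * (‖(L - K ∘L J) v‖ + ‖K‖ * (C * ‖(L - K ∘L J) v‖)) := by
        gcongr
        rw [h1]
        refine (norm_add_le _ _).trans ?_
        gcongr
        exact (K.le_opNorm _).trans (by gcongr; exact hC v)
      _ = _ := by ring
  have hanti : AntilipschitzWith (‖L.inverse‖ * (1 + ‖K‖ * C)).toNNReal (L - K ∘L J) :=
    AddMonoidHomClass.antilipschitz_of_bound _ fun v =>
      (hbelow v).trans (by gcongr; exact Real.le_coe_toNNReal _)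
  have hclosed := hanti.isClosed_range (L - K ∘L J).uniformContinuous
  have horth : (LinearMap.range (L - K ∘L J).toLinearMap)ᗮ = ⊥ := by
    refine (Submodule.eq_bot_iff _).2 fun Φ hΦ => ?_
    have h1 : ∀ v, inner ℂ Φ (L v) = inner ℂ (adjoint K Φ) (J v) := by
      intro v
      have := (Submodule.mem_orthogonal' _ _).1 hΦ _ (LinearMap.mem_range_self _ v)
      rw [ContinuousLinearMap.coe_coe, sub_apply, ContinuousLinearMap.comp_apply,
        inner_sub_right, sub_eq_zero] at this
      rw [this, ContinuousLinearMap.adjoint_inner_left]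
    -- `Φ` lies in the domain of the formal adjoint, hence in its kernel.
    obtain ⟨u, hu⟩ := hL' (adjoint K Φ)
    have h2 : Φ = J u := by
      refine ext_inner_right ℂ fun w => ?_
      obtain ⟨v, rfl⟩ := hL.surjective w
      rw [h1, ← hu, hadj]
    rw [h2] at hu ⊢
    exact hinj u hu
  have htop : LinearMap.range (L - K ∘L J).toLinearMap = ⊤ := by
    rw [← Submodule.topologicalClosure_eq_top_iff] at horth
    rw [← horth, IsClosed.submodule_topologicalClosure_eq]
    exact hclosed
  exact ⟨ContinuousLinearEquiv.ofBijective (L - K ∘L J)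
    (LinearMap.ker_eq_bot.2 hanti.injective) htop, rfl⟩

/-- The graph of a parametrised operator. -/
theorem LinearPMap.mem_graph_ofParam {V E F : Type*} [AddCommGroup V] [Module ℂ V]
    [AddCommGroup E] [Module ℂ E] [AddCommGroup F] [Module ℂ F] {J : V →ₗ[ℂ] E}
    {hJ : Function.Injective J} {T : V →ₗ[ℂ] F} {p : E × F} :
    p ∈ (LinearPMap.ofParam J hJ T).graph ↔ ∃ v, J v = p.1 ∧ T v = p.2 := by
  rw [LinearPMap.mem_graph_iff]
  constructor
  · rintro ⟨⟨_, v, rfl⟩, h1, h2⟩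
    exact ⟨v, h1, (LinearPMap.ofParam_apply J hJ T v).symm.trans h2⟩
  · rintro ⟨v, h1, h2⟩
    exact ⟨⟨J v, LinearMap.mem_range_self J v⟩, h1, (LinearPMap.ofParam_apply J hJ T v).trans h2⟩

namespace BosonField

variable {X : Type*} [MeasurableSpace X] {B : BosonField X}
variable {he hg : Type*} [NormedAddCommGroup he] [InnerProductSpace ℂ he] [CompleteSpace he]
  [NormedAddCommGroup hg] [InnerProductSpace ℂ hg] [CompleteSpace hg]
variable {Ee : he →L[ℂ] he} {Eg : hg →L[ℂ] hg} {r : ℕ} {S : Fin r → hg →L[ℂ] he} {lam : ℝ}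
  {f : Fin r → B.HScale (-1)} {z : ℂ}

/-! ### The self-energy and the propagator -/

theorem pairing_couplingDag (χ : B.Fock he 0) (Φ : B.Fock hg 1) :
    B.pairing (B.couplingDag S f χ) Φ = inner ℂ χ (B.coupling S f Φ) :=
  B.pairing_pairingAdjoint _ _ _

theorem selfEnergy_apply (χ : B.Fock he 0) :
    B.selfEnergy Eg S f z χ = B.coupling S f (B.freeResolvent Eg z (B.couplingDag S f χ)) := rfl

theorem propagatorInv_apply (χ : B.Fock he 2) :
    B.propagatorInv Ee Eg S lam f z χ = B.free Ee (by norm_num) χ - z • B.incl (by norm_num) χ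
      - (lam : ℂ) ^ 2 • B.selfEnergy Eg S f z (B.incl (by norm_num) χ) := rfl

variable [FiniteDimensional ℂ hg]

theorem freeSub_freeResolvent (hEg : Eg.IsPositive) (hz : OffHalfLine z) (Ξ : B.Fock hg (-1)) :
    B.freeSub Eg z (B.freeResolvent Eg z Ξ) = Ξ :=
  (isInvertible_freeSub hEg hz).self_apply_inverse Ξ

/-- `S_f(z)† = S_f(z̄)`. -/
theorem inner_selfEnergy (hEg : Eg.IsPositive) (hz : OffHalfLine z) (hz' : OffHalfLine (conj z))
    (χ' χ : B.Fock he 0) :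
    inner ℂ χ' (B.selfEnergy Eg S f z χ) = inner ℂ (B.selfEnergy Eg S f (conj z) χ') χ := by
  have h1 := pairing_freeSub_symm (z := z) hEg (B.freeResolvent Eg z (B.couplingDag S f χ))
    (B.freeResolvent Eg (conj z) (B.couplingDag S f χ'))
  rw [freeSub_freeResolvent hEg hz, freeSub_freeResolvent hEg hz', pairing_couplingDag,
    pairing_couplingDag, inner_fock_conj_symm] at h1
  exact h1

/-- The imaginary part of the self-energy has the sign of `Im z`. -/
theorem im_inner_selfEnergy (hEg : Eg.IsPositive) (hz : OffHalfLine z) (χ : B.Fock he 0) :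
    (inner ℂ χ (B.selfEnergy Eg S f z χ)).im
      = z.im * ‖B.incl (t := 0) (by norm_num) (B.freeResolvent Eg z (B.couplingDag S f χ))‖ ^ 2 := by
  set Φ := B.freeResolvent Eg z (B.couplingDag S f χ) with hΦ
  have h1 : B.couplingDag S f χ = B.freeSub Eg z Φ := (freeSub_freeResolvent hEg hz _).symm
  have h2 : (B.pairing (B.free Eg (by norm_num) Φ) Φ).im = 0 :=
    Complex.conj_eq_iff_im.1 (pairing_free_symm hEg.inner_left_eq_inner_right Φ Φ).symm
  rw [selfEnergy_apply, ← hΦ, ← pairing_couplingDag, h1, freeSub_apply, pairing_sub_left,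
    pairing_smul_left, pairing_incl_left', Complex.sub_im, h2, inner_fock_self,
    Complex.im_mul_ofReal]
  simp

/-- `|Im ⟨χ, G_f(z) χ⟩| ≥ |Im z| ‖χ‖²`, since the self-energy only enlarges the imaginary part. -/
theorem norm_incl_le_norm_propagatorInv (hEe : Ee.IsPositive) (hEg : Eg.IsPositive)
    (hz : z.im ≠ 0) (χ : B.Fock he 2) :
    ‖B.incl (t := 0) (by norm_num) χ‖ ≤ |z.im|⁻¹ * ‖B.propagatorInv Ee Eg S lam f z χ‖ := by
  set χ₀ : B.Fock he 0 := B.incl (by norm_num) χ with hχ₀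
  set Φ₀ : B.Fock hg 0 :=
    B.incl (by norm_num) (B.freeResolvent Eg z (B.couplingDag S f χ₀)) with hΦ₀
  have h1 : (inner ℂ χ₀ (B.free (t := 0) Ee (by norm_num) χ)).im = 0 := by
    refine Complex.conj_eq_iff_im.1 ?_
    rw [inner_fock_conj_symm, hχ₀, inner_free_symm hEe.inner_left_eq_inner_right]
  have h2 : (inner ℂ χ₀ (B.propagatorInv Ee Eg S lam f z χ)).im
      = -(z.im * (‖χ₀‖ ^ 2 + lam ^ 2 * ‖Φ₀‖ ^ 2)) := by
    rw [propagatorInv_apply, inner_sub_right, inner_sub_right, inner_fock_smul_right,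
      inner_fock_smul_right, ← hχ₀, Complex.sub_im, Complex.sub_im, h1, inner_fock_self,
      ← Complex.ofReal_pow, Complex.im_ofReal_mul, Complex.im_mul_ofReal,
      im_inner_selfEnergy hEg (offHalfLine_of_im_ne_zero hz), ← hΦ₀]
    ring
  have h3 : |z.im| * ‖χ₀‖ ^ 2 ≤ ‖χ₀‖ * ‖B.propagatorInv Ee Eg S lam f z χ‖ := by
    calc |z.im| * ‖χ₀‖ ^ 2 ≤ |z.im| * (‖χ₀‖ ^ 2 + lam ^ 2 * ‖Φ₀‖ ^ 2) := by
          gcongr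
          nlinarith [sq_nonneg (lam * ‖Φ₀‖)]
      _ = |(inner ℂ χ₀ (B.propagatorInv Ee Eg S lam f z χ)).im| := by
          rw [h2, abs_neg, abs_mul, abs_of_nonneg (a := _ + _) (by positivity)]
      _ ≤ _ := (Complex.abs_im_le_norm _).trans (norm_inner_fock_le _ _)
  have h4 : 0 < |z.im| := abs_pos.2 hz
  rw [inv_mul_eq_div, le_div_iff₀ h4, mul_comm]
  rcases (norm_nonneg χ₀).eq_or_lt with h5 | h5
  · rw [← h5, mul_zero]; exact norm_nonneg _
  · nlinarith

variable [FiniteDimensional ℂ he]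

/-- `G_f(z)` is the bounded perturbation `h_e - z - λ² S_f(z)` of the invertible `h_e - z`. It is
bounded below, and so is its formal adjoint `G_f(z̄)`. -/
theorem isInvertible_propagatorInv (hEe : Ee.IsPositive) (hEg : Eg.IsPositive) (hz : z.im ≠ 0) :
    (B.propagatorInv Ee Eg S lam f z).IsInvertible := by
  have hz' : (conj z).im ≠ 0 := by simpa using hz
  have hG : ∀ w : ℂ, B.propagatorInv Ee Eg S lam f w
      = (B.free Ee (by norm_num) - w • (B.incl (by norm_num) : B.Fock he 2 →L[ℂ] B.Fock he 0))
        - ((lam : ℂ) ^ 2 • B.selfEnergy Eg S f w) ∘L B.incl (by norm_num) := fun w => rfl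
  have hadj : ContinuousLinearMap.adjoint ((lam : ℂ) ^ 2 • B.selfEnergy Eg S f z)
      = (lam : ℂ) ^ 2 • B.selfEnergy Eg S f (conj z) := by
    symm
    refine (ContinuousLinearMap.eq_adjoint_iff _ _).2 fun χ' χ => ?_
    rw [smul_apply, smul_apply, inner_fock_smul_left, inner_fock_smul_right,
      inner_selfEnergy hEg (offHalfLine_of_im_ne_zero hz) (offHalfLine_of_im_ne_zero hz')]
    simp
  rw [hG]
  refine ContinuousLinearMap.isInvertible_sub_of_bounded_below (C := |z.im|⁻¹)
    (L' := B.free Ee (by norm_num)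
      - conj z • (B.incl (by norm_num) : B.Fock he 2 →L[ℂ] B.Fock he 0))
    (isInvertible_free_sub hEe (offHalfLine_of_im_ne_zero hz) (by norm_num))
    (isInvertible_free_sub hEe (offHalfLine_of_im_ne_zero hz') (by norm_num)).surjective
    (fun u v => ?_) (fun v => ?_) (fun u hu => ?_)
  · simp only [sub_apply, smul_apply, inner_sub_left, inner_sub_right,
      inner_fock_smul_left, inner_fock_smul_right, Complex.conj_conj,
      inner_free_symm hEe.inner_left_eq_inner_right]
  · rw [← hG]
    exact norm_incl_le_norm_propagatorInv hEe hEg hz v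
  · have h1 := norm_incl_le_norm_propagatorInv (S := S) (lam := lam) (f := f) hEe hEg hz' u
    rw [hadj] at hu
    rw [hG, sub_apply, hu, ContinuousLinearMap.comp_apply, sub_self, norm_zero, mul_zero] at h1
    exact norm_le_zero_iff.1 h1

end BosonField

namespace BosonField

variable {X : Type*} [MeasurableSpace X] {B : BosonField X}
variable {he hg : Type*} [NormedAddCommGroup he] [InnerProductSpace ℂ he] [CompleteSpace he]
  [NormedAddCommGroup hg] [InnerProductSpace ℂ hg] [CompleteSpace hg]
variable {Ee : he →L[ℂ] he} {Eg : hg →L[ℂ] hg} {r : ℕ} {S : Fin r → hg →L[ℂ] he} {lam : ℝ}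
  {f : Fin r → B.HScale (-1)} {z : ℂ}

/-! ### The graph of the singular Hamiltonian -/

theorem singularState_apply (χ : B.Fock he 2) (Φ : B.Fock hg 2) :
    B.singularState Eg S lam f (χ, Φ) = WithLp.toLp 2 (B.incl (by norm_num) χ,
      B.incl (by norm_num) Φ - (lam : ℂ) • B.incl (by norm_num)
        (B.freeResolvent Eg (-1) (B.couplingDag S f (B.incl (by norm_num) χ)))) := rfl

theorem fst_singularAction (χ : B.Fock he 2) (Φ : B.Fock hg 2) :
    (B.singularAction Ee Eg S lam f (χ, Φ)).fst = B.free Ee (by norm_num) χ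
        - (lam : ℂ) ^ 2 • B.selfEnergy Eg S f (-1) (B.incl (by norm_num) χ)
        + (lam : ℂ) • B.coupling S f (B.incl (by norm_num) Φ) := rfl

theorem snd_singularAction (χ : B.Fock he 2) (Φ : B.Fock hg 2) :
    (B.singularAction Ee Eg S lam f (χ, Φ)).snd = B.free Eg (by norm_num) Φ
        + (lam : ℂ) • B.incl (by norm_num)
          (B.freeResolvent Eg (-1) (B.couplingDag S f (B.incl (by norm_num) χ))) := rfl

section Graph

variable [FiniteDimensional ℂ hg]

/-- `h_g (h_g + 1)⁻¹ = 1 - (h_g + 1)⁻¹` on `h_g ⊗ F_{-1}`. -/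
theorem free_freeResolvent_neg_one (hEg : Eg.IsPositive) (Ξ : B.Fock hg (-1)) :
    B.free Eg (by norm_num) (B.freeResolvent Eg (-1) Ξ)
      = Ξ - B.incl (by norm_num) (B.freeResolvent Eg (-1) Ξ) := by
  have h1 := freeSub_freeResolvent hEg offHalfLine_neg_one Ξ
  rw [freeSub_apply, neg_one_smul, sub_neg_eq_add] at h1
  exact eq_sub_of_add_eq h1

/-- Regularity: an `η ∈ h_g ⊗ F_1` for which `h_g η` lies in `h_g ⊗ F` belongs to `D(h_g)`. -/
theorem exists_incl_eq_of_free_eq_incl (hEg : Eg.IsPositive) {η : B.Fock hg 1} {Θ : B.Fock hg 0}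
    (h : B.free Eg (by norm_num) η = B.incl (t := -1) (by norm_num) Θ) :
    ∃ Φ : B.Fock hg 2, B.incl (by norm_num) Φ = η ∧ B.free Eg (by norm_num) Φ = Θ := by
  obtain ⟨Φ, hΦ⟩ := (isInvertible_free_sub (B := B) (s := 2) (t := 0) hEg offHalfLine_neg_one
    (by norm_num)).surjective (Θ + B.incl (by norm_num) η)
  rw [sub_apply, smul_apply, neg_one_smul, sub_neg_eq_add] at hΦ
  have h1 : B.incl (by norm_num) Φ = η := by
    refine (isInvertible_freeSub hEg offHalfLine_neg_one).injective ?_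
    have h2 := congrArg (B.incl (t := -1) (by norm_num)) hΦ
    rw [map_add, map_add, incl_free, incl_incl, incl_incl] at h2
    rw [freeSub_apply, freeSub_apply, neg_one_smul, neg_one_smul, sub_neg_eq_add, sub_neg_eq_add,
      free_incl, incl_incl, h, h2]
  refine ⟨Φ, h1, ?_⟩
  rw [← h1, incl_incl] at hΦ
  exact add_right_cancel hΦ

set_option maxHeartbeats 1000000 in
/-- In the scale of spaces the singular Hamiltonian acts as the formal matrix of operators
`(h_e, λ A_f; λ A_f†, h_g)`, on the pairs in `F_2 × F_1` for which the second component of the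
result, a priori in `F_{-1}`, lies in the Hilbert space. -/
theorem mem_graph_singularHamiltonian_iff (hEg : Eg.IsPositive) {Ψ Θ : B.TotalSpace he hg} :
    (Ψ, Θ) ∈ (B.singularHamiltonian Ee Eg S lam f).graph ↔
      ∃ (χ : B.Fock he 2) (η : B.Fock hg 1),
        Ψ = WithLp.toLp 2 (B.incl (by norm_num) χ, B.incl (by norm_num) η) ∧
        B.free Ee (by norm_num) χ + (lam : ℂ) • B.coupling S f η = Θ.fst ∧
        B.free Eg (by norm_num) η + (lam : ℂ) • B.couplingDag S f (B.incl (by norm_num) χ)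
          = B.incl (by norm_num) Θ.snd := by
  have hz := offHalfLine_neg_one
  rw [singularHamiltonian, LinearPMap.mem_graph_ofParam]
  constructor
  · rintro ⟨⟨χ, Φ⟩, h1, h2⟩
    replace h1 : B.singularState Eg S lam f (χ, Φ) = Ψ := h1
    replace h2 : B.singularAction Ee Eg S lam f (χ, Φ) = Θ := h2
    set ξ := B.freeResolvent Eg (-1) (B.couplingDag S f (B.incl (by norm_num) χ)) with hξ
    refine ⟨χ, B.incl (by norm_num) Φ - (lam : ℂ) • ξ, ?_, ?_, ?_⟩
    · rw [← h1, singularState_apply, ← hξ, map_sub, map_smul, incl_incl]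
    · rw [← h2, fst_singularAction, map_sub, map_smul, selfEnergy_apply, ← hξ, smul_sub, smul_smul,
        ← pow_two]
      abel
    · rw [← h2, snd_singularAction, ← hξ, map_sub, map_smul, free_incl, map_add, map_smul,
        incl_free, incl_incl, hξ, free_freeResolvent_neg_one hEg, ← hξ, smul_sub]
      abel
  · rintro ⟨χ, η, rfl, h1, h2⟩
    set ξ := B.freeResolvent Eg (-1) (B.couplingDag S f (B.incl (by norm_num) χ)) with hξ
    -- `h_g (η + λ ξ) = Θ_g - λ ξ` lies in `F`, hence `η + λ ξ` in `D(h_g)`.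
    obtain ⟨Φ, h3, h4⟩ := exists_incl_eq_of_free_eq_incl hEg (η := η + (lam : ℂ) • ξ)
      (Θ := Θ.snd + (lam : ℂ) • -B.incl (by norm_num) ξ) (by
        rw [map_add, map_smul, hξ, free_freeResolvent_neg_one hEg, ← hξ, map_add, map_smul,
          map_neg, incl_incl, ← h2, smul_sub, smul_neg]
        abel)
    have h5 : η = B.incl (by norm_num) Φ - (lam : ℂ) • ξ := by rw [h3]; abel
    refine ⟨(χ, Φ), ?_, (WithLp.ofLp_injective 2) (Prod.ext ?_ ?_)⟩
    · rw [singularState_apply, ← hξ, h5, map_sub, map_smul, incl_incl]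
    · change (B.singularAction Ee Eg S lam f (χ, Φ)).fst = Θ.fst
      rw [fst_singularAction, ← h1, h5, map_sub, map_smul, selfEnergy_apply, ← hξ, smul_sub,
        smul_smul, ← pow_two]
      abel
    · change (B.singularAction Ee Eg S lam f (χ, Φ)).snd = Θ.snd
      rw [snd_singularAction, ← hξ, h4, smul_neg, neg_add_cancel_right]

/-- The singular Hamiltonian is symmetric: in the scale its matrix is formally symmetric. -/
theorem isFormalAdjoint_singularHamiltonian (hEe : Ee.IsPositive) (hEg : Eg.IsPositive) :
    (B.singularHamiltonian Ee Eg S lam f).IsFormalAdjoint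
      (B.singularHamiltonian Ee Eg S lam f) := by
  intro Ψ Ψ'
  obtain ⟨χ, η, h1, h2, h3⟩ :=
    (mem_graph_singularHamiltonian_iff hEg).1 (LinearPMap.mem_graph _ Ψ)
  obtain ⟨χ', η', h1', h2', h3'⟩ :=
    (mem_graph_singularHamiltonian_iff hEg).1 (LinearPMap.mem_graph _ Ψ')
  set Θ := B.singularHamiltonian Ee Eg S lam f Ψ
  set Θ' := B.singularHamiltonian Ee Eg S lam f Ψ'
  rw [h1, h1']
  change inner ℂ Θ.fst (B.incl (by norm_num) χ') + inner ℂ Θ.snd (B.incl (by norm_num) η')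
    = inner ℂ (B.incl (by norm_num) χ) Θ'.fst + inner ℂ (B.incl (by norm_num) η) Θ'.snd
  rw [← inner_fock_conj_symm Θ'.snd, ← pairing_incl_left, ← pairing_incl_left, ← h2, ← h2', ← h3,
    ← h3', inner_add_left, inner_add_right, pairing_add_left,
    pairing_add_left, pairing_smul_left, pairing_smul_left, pairing_couplingDag,
    pairing_couplingDag, inner_fock_smul_left, inner_fock_smul_right,
    inner_free_symm hEe.inner_left_eq_inner_right,
    pairing_free_symm hEg.inner_left_eq_inner_right η η', map_add, map_mul, Complex.conj_conj,
    inner_fock_conj_symm, Complex.conj_ofReal]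
  ring

end Graph

/-! ### The resolvent -/

/-- The explicit expression `resolventFormula` for the resolvent, as a bounded operator. -/
def resolventOp (B : BosonField X) (Ee : he →L[ℂ] he) (Eg : hg →L[ℂ] hg) (S : Fin r → hg →L[ℂ] he)
    (lam : ℝ) (f : Fin r → B.HScale (-1)) (z : ℂ) : B.TotalSpace he hg →L[ℂ] B.TotalSpace he hg :=
  let Rg : B.TotalSpace he hg →L[ℂ] B.Fock hg 1 :=
    B.freeResolvent Eg z ∘L B.incl (by norm_num) ∘L WithLp.sndL 2 ℂ (B.Fock he 0) (B.Fock hg 0)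
  let χ : B.TotalSpace he hg →L[ℂ] B.Fock he 0 := B.incl (s := 2) (by norm_num) ∘L
    (B.propagatorInv Ee Eg S lam f z).inverse ∘L
      (WithLp.fstL 2 ℂ (B.Fock he 0) (B.Fock hg 0) - (lam : ℂ) • (B.coupling S f ∘L Rg))
  let i : B.Fock hg 1 →L[ℂ] B.Fock hg 0 := B.incl (by norm_num)
  (WithLp.prodContinuousLinearEquiv 2 ℂ (B.Fock he 0) (B.Fock hg 0)).symm.toContinuousLinearMap ∘L
    χ.prod (i ∘L Rg - (lam : ℂ) • (i ∘L B.freeResolvent Eg z ∘L B.couplingDag S f ∘L χ))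

theorem resolventOp_apply (Ψe : B.Fock he 0) (Ψg : B.Fock hg 0) :
    B.resolventOp Ee Eg S lam f z (WithLp.toLp 2 (Ψe, Ψg))
      = B.resolventFormula Ee Eg S lam f z Ψe Ψg := rfl

variable [FiniteDimensional ℂ hg] [FiniteDimensional ℂ he]

set_option maxHeartbeats 1000000 in
/-- `(H_f - z) Ψ = Θ` is the block system `(h_e - z) χ + λ A_f η = Θ_e`,
`(h_g - z) η + λ A_f† χ = Θ_g`. Eliminating `η` leaves `G_f(z) χ = Θ_e - λ A_f (h_g - z)⁻¹ Θ_g`, and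
its solution is the resolvent formula. -/
theorem mem_graph_iff_eq_resolventOp (hEe : Ee.IsPositive) (hEg : Eg.IsPositive) (hz : z.im ≠ 0)
    {Ψ Θ : B.TotalSpace he hg} :
    (Ψ, Θ + z • Ψ) ∈ (B.singularHamiltonian Ee Eg S lam f).graph ↔
      Ψ = B.resolventOp Ee Eg S lam f z Θ := by
  have hz' := offHalfLine_of_im_ne_zero hz
  have hG := isInvertible_propagatorInv (B := B) (S := S) (lam := lam) (f := f) hEe hEg hz
  obtain ⟨Θe, Θg, rfl⟩ : ∃ Θe Θg, Θ = WithLp.toLp 2 (Θe, Θg) := ⟨Θ.fst, Θ.snd, rfl⟩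
  change _ ↔ Ψ = B.resolventOp Ee Eg S lam f z (WithLp.toLp 2 (Θe, Θg))
  rw [mem_graph_singularHamiltonian_iff hEg, resolventOp_apply, resolventFormula]
  set Rg := B.freeResolvent Eg z (B.incl (by norm_num) Θg) with hRg
  constructor
  · rintro ⟨χ, η, rfl, h1, h2⟩
    replace h1 : B.free Ee (by norm_num) χ + (lam : ℂ) • B.coupling S f η
      = Θe + z • B.incl (by norm_num) χ := h1
    replace h2 : B.free Eg (by norm_num) η
        + (lam : ℂ) • B.couplingDag S f (B.incl (by norm_num) χ)
      = B.incl (by norm_num) (Θg + z • B.incl (by norm_num) η) := h2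
    have h3 : η = Rg - (lam : ℂ) •
        B.freeResolvent Eg z (B.couplingDag S f (B.incl (by norm_num) χ)) := by
      refine (isInvertible_freeSub hEg hz').injective ?_
      rw [map_sub, map_smul, hRg, freeSub_freeResolvent hEg hz', freeSub_freeResolvent hEg hz',
        freeSub_apply, eq_sub_of_add_eq h2, map_add, map_smul, incl_incl]
      abel
    have h4 : χ = (B.propagatorInv Ee Eg S lam f z).inverse
        (Θe - (lam : ℂ) • B.coupling S f Rg) := by
      refine hG.injective ?_
      rw [hG.self_apply_inverse, propagatorInv_apply, eq_sub_of_add_eq h1, h3, map_sub, map_smul,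
        selfEnergy_apply, smul_sub, smul_smul, ← pow_two]
      abel
    rw [← h4]
    conv_lhs => rw [h3]
    rw [map_sub, map_smul]
  · rintro rfl
    set χ := (B.propagatorInv Ee Eg S lam f z).inverse
        (Θe - (lam : ℂ) • B.coupling S f Rg) with hχ
    have h4 := hG.self_apply_inverse (Θe - (lam : ℂ) • B.coupling S f Rg)
    rw [← hχ, propagatorInv_apply, selfEnergy_apply] at h4
    refine ⟨χ, Rg - (lam : ℂ) •
        B.freeResolvent Eg z (B.couplingDag S f (B.incl (by norm_num) χ)), ?_, ?_, ?_⟩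
    · rw [map_sub, map_smul]
    · change _ = Θe + z • B.incl (by norm_num) χ
      rw [map_sub, map_smul, smul_sub, smul_smul, ← pow_two]
      rw [sub_eq_iff_eq_add, sub_eq_iff_eq_add] at h4
      rw [h4]
      abel
    · set ζ := B.freeResolvent Eg z (B.couplingDag S f (B.incl (by norm_num) χ)) with hζ
      change _ = B.incl (by norm_num)
        (Θg + z • (B.incl (by norm_num) Rg - (lam : ℂ) • B.incl (by norm_num) ζ))
      have h5 := freeSub_freeResolvent hEg hz' (B.incl (by norm_num) Θg)
      have h6 := freeSub_freeResolvent hEg hz' (B.couplingDag S f (B.incl (by norm_num) χ))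
      rw [← hRg, freeSub_apply] at h5
      rw [← hζ, freeSub_apply] at h6
      have h7 : B.incl (t := -1) (by norm_num)
          (Θg + z • (B.incl (by norm_num) Rg - (lam : ℂ) • B.incl (by norm_num) ζ))
          = B.incl (by norm_num) Θg
            + z • (B.incl (by norm_num) Rg - (lam : ℂ) • B.incl (by norm_num) ζ) := by
        rw [map_add, map_smul, map_sub, map_smul, incl_incl, incl_incl]
      rw [h7, ← h5, ← h6, map_sub, map_smul, smul_sub, smul_sub, smul_comm (lam : ℂ) z]
      abel

theorem isResolventAt_resolventOp (hEe : Ee.IsPositive) (hEg : Eg.IsPositive) (hz : z.im ≠ 0) :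
    IsResolventAt (E := B.TotalSpace he hg) (B.singularHamiltonian Ee Eg S lam f) z
      (B.resolventOp Ee Eg S lam f z) := by
  constructor
  · intro Φ
    obtain ⟨x, h1, h2⟩ := (LinearPMap.mem_graph_iff _).1
      ((mem_graph_iff_eq_resolventOp (B := B) (S := S) (lam := lam) (f := f) (Θ := Φ)
        hEe hEg hz).2 rfl)
    simp only at h1 h2
    refine ⟨h1 ▸ x.2, ?_⟩
    have h3 : (⟨B.resolventOp Ee Eg S lam f z Φ, h1 ▸ x.2⟩ :
      (B.singularHamiltonian Ee Eg S lam f).domain) = x := Subtype.ext h1.symm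
    rw [h3, h2, add_sub_cancel_right]
  · intro Ψ
    refine ((mem_graph_iff_eq_resolventOp hEe hEg hz).1 ?_).symm
    rw [sub_add_cancel]
    exact LinearPMap.mem_graph _ Ψ

theorem isSelfAdjoint_singularHamiltonian (hEe : Ee.IsPositive) (hEg : Eg.IsPositive) :
    IsSelfAdjoint (B.singularHamiltonian Ee Eg S lam f) := by
  have hsurj : ∀ w : ℂ, w.im ≠ 0 → ∀ Φ : B.TotalSpace he hg,
      ∃ x : (B.singularHamiltonian Ee Eg S lam f).domain,
        B.singularHamiltonian Ee Eg S lam f x - w • (x : B.TotalSpace he hg) = Φ := by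
    intro w hw Φ
    obtain ⟨h1, h2⟩ := (isResolventAt_resolventOp (S := S) (lam := lam) (f := f) hEe hEg hw).1 Φ
    exact ⟨⟨_, h1⟩, h2⟩
  exact LinearPMap.isSelfAdjoint_of_surjective _ (isFormalAdjoint_singularHamiltonian hEe hEg)
    Complex.I (hsurj _ (by simp)) (hsurj _ (by simp))

end BosonField

namespace BosonField

variable {X : Type*} [MeasurableSpace X] {B : BosonField X}
variable {h h' : Type*} [NormedAddCommGroup h] [InnerProductSpace ℂ h]
  [NormedAddCommGroup h'] [InnerProductSpace ℂ h']

/-! ### Form factors in `L²` -/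

/-- The particle number is dominated by the free energy, because of the positive mass. -/
theorem exists_number_le_energy (B : BosonField X) :
    ∃ C : ℝ≥0, ∀ γ : Config X, (γ.1 : ℝ) + 1 ≤ C * (B.energy γ + 1) := by
  obtain ⟨m, hm, hω⟩ := B.mass_pos
  refine ⟨⟨m⁻¹ + 1, by positivity⟩, fun γ => ?_⟩
  have h1 : (γ.1 : ℝ) * m ≤ B.energy γ := by
    have := Finset.sum_le_sum fun (i : Fin γ.1) (_ : i ∈ Finset.univ) => hω (γ.2 i)
    simpa [energy] using this
  have h2 : (γ.1 : ℝ) ≤ m⁻¹ * B.energy γ := by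
    rw [inv_mul_eq_div, le_div_iff₀ hm]
    exact h1
  have h3 := B.energy_nonneg γ
  have h4 : 0 < m⁻¹ := by positivity
  change _ ≤ (m⁻¹ + 1) * (B.energy γ + 1)
  nlinarith

theorem lintegral_lintegral_snoc_le {E : Type*} [NormedAddCommGroup E] {Ψ : Config X → E}
    (hΨ : StronglyMeasurable Ψ) :
    ∫⁻ γ, ∫⁻ k, ‖Ψ ⟨γ.1 + 1, Fin.snoc γ.2 k⟩‖ₑ ^ 2 ∂B.μ ∂B.configMeasure
      ≤ ∫⁻ γ, ‖Ψ γ‖ₑ ^ 2 ∂B.configMeasure := by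
  have hme : ∀ n, Measurable fun k : Fin n → X => ‖Ψ ⟨n, k⟩‖ₑ ^ 2 := fun n =>
    (hΨ.enorm.comp (measurable_sigma_mk n)).pow_const 2
  have hm : ∀ n, Measurable fun p : (Fin n → X) × X => ‖Ψ ⟨n + 1, Fin.snoc p.1 p.2⟩‖ₑ ^ 2 :=
    fun n => (hme (n + 1)).comp (B.measurePreserving_snoc n).measurable
  rw [lintegral_config _ (hΨ.enorm.pow_const 2),
    lintegral_config _ (measurable_config fun n => (hm n).lintegral_prod_right')]
  refine le_trans (ENNReal.tsum_le_tsum fun n => ?_)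
    (ENNReal.tsum_comp_le_tsum_of_injective (Nat.succ_injective) _)
  change ∫⁻ k : Fin n → X, ∫⁻ k', ‖Ψ ⟨n + 1, Fin.snoc k k'⟩‖ₑ ^ 2 ∂B.μ
    ∂(Measure.pi fun _ => B.μ) ≤ _
  rw [← lintegral_prod _ (hm n).aemeasurable, ← (B.measurePreserving_snoc n).lintegral_comp
    (hme (n + 1))]

/-- The Cauchy-Schwarz inequality in the last particle, unweighted. -/
theorem lintegral_fiber_sq_le_of_L2 {f : X → ℂ} (hf : AEMeasurable f B.μ) {g : X → h}
    (hg : StronglyMeasurable g) :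
    (∫⁻ k, ‖conj (f k) • g k‖ₑ ∂B.μ) ^ 2 ≤ eLpNorm f 2 B.μ ^ 2 * ∫⁻ k, ‖g k‖ₑ ^ 2 ∂B.μ := by
  have hn : eLpNorm f 2 B.μ ^ 2 = ∫⁻ k, ‖f k‖ₑ ^ 2 ∂B.μ := by
    simpa using eLpNorm_nnreal_pow_eq_lintegral (f := f) (μ := B.μ) (p := 2) (by norm_num)
  have H := ENNReal.lintegral_mul_le_Lp_mul_Lq B.μ Real.HolderConjugate.two_two
    (f := fun k => ‖f k‖ₑ) (g := fun k => ‖g k‖ₑ) hf.enorm hg.enorm.aemeasurable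
  have e4 : ∀ k, ‖conj (f k) • g k‖ₑ = ‖f k‖ₑ * ‖g k‖ₑ := fun k => by
    rw [enorm_smul]
    congr 1
    exact RCLike.enorm_conj _
  simp only [ENNReal.rpow_two, Pi.mul_apply, ← e4] at H
  rw [hn]
  calc _ ≤ _ := pow_le_pow_left' H 2
    _ = _ := by
      rw [mul_pow, ← ENNReal.rpow_two, ← ENNReal.rpow_two, ← ENNReal.rpow_mul, ← ENNReal.rpow_mul]
      norm_num

/-- For `f ∈ L²` the annihilation operator extends to a bounded operator from `F_0` to `F_{-1}`:
the factor `n + 1` is absorbed by the weight of `F_{-1}`. -/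
theorem exists_norm_incl_annihilation_le {f : B.HScale (-1)} (hf : MemLp f 2 B.μ) :
    ∃ C : ℝ≥0, ∀ Φ : B.Fock h 1, ‖B.incl (t := -1) (by norm_num) (B.annihilation f Φ)‖
      ≤ C * ‖B.incl (t := 0) (by norm_num) Φ‖ := by
  obtain ⟨C, hC⟩ := exists_number_le_energy B
  set N : ℝ≥0 := (eLpNorm f 2 B.μ).toNNReal with hN
  have hN' : (N : ℝ≥0∞) = eLpNorm f 2 B.μ := ENNReal.coe_toNNReal hf.2.ne
  refine ⟨NNReal.sqrt C * N, fun Φ => ?_⟩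
  set Φ₀ : B.Fock h 0 := B.incl (by norm_num) Φ
  have hΦ : StronglyMeasurable Φ.1 := Lp.stronglyMeasurable Φ.1
  have h1 : ∫⁻ γ, ENNReal.ofReal ((B.energy γ + 1) ^ (-1 : ℝ)) * ‖B.annihilationFun f Φ.1 γ‖ₑ ^ 2
      ∂B.configMeasure ≤ ((NNReal.sqrt C * N : ℝ≥0) : ℝ≥0∞) ^ 2 *
        ∫⁻ γ, ENNReal.ofReal ((B.energy γ + 1) ^ (0 : ℝ)) * ‖Φ.1 γ‖ₑ ^ 2 ∂B.configMeasure := by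
    simp only [Real.rpow_zero, ENNReal.ofReal_one, one_mul]
    refine le_trans ?_ (mul_le_mul_right (lintegral_lintegral_snoc_le hΦ) _)
    rw [← lintegral_const_mul' _ _ (by finiteness)]
    refine lintegral_mono fun γ => ?_
    have hg : StronglyMeasurable fun k' : X => Φ.1 (⟨γ.1 + 1, Fin.snoc γ.2 k'⟩ : Config X) :=
      hΦ.comp_measurable (measurable_snoc_right γ)
    have h2 := (pow_le_pow_left' (enorm_integral_le_lintegral_enorm
      (μ := B.μ) fun k' => conj (f k') • Φ.1 ⟨γ.1 + 1, Fin.snoc γ.2 k'⟩) 2).trans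
      (lintegral_fiber_sq_le_of_L2 (B := B) hf.1.aemeasurable hg)
    have h3 : ‖(√(γ.1 + 1 : ℝ) : ℂ)‖ₑ ^ 2 = ENNReal.ofReal (γ.1 + 1) := by
      rw [← ofReal_norm, Complex.norm_real, Real.norm_eq_abs, ← ENNReal.ofReal_pow (abs_nonneg _),
        sq_abs, Real.sq_sqrt (by positivity)]
    have h0 : 0 < B.energy γ + 1 := by linarith [B.energy_nonneg γ]
    have h4 : ENNReal.ofReal ((B.energy γ + 1) ^ (-1 : ℝ)) * ENNReal.ofReal (γ.1 + 1) ≤ C := by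
      rw [← ENNReal.ofReal_mul (by positivity), Real.rpow_neg_one, ← ENNReal.ofReal_coe_nnreal]
      refine ENNReal.ofReal_le_ofReal ?_
      rw [inv_mul_le_iff₀ h0, mul_comm]
      exact hC γ
    have h5 : ((NNReal.sqrt C * N : ℝ≥0) : ℝ≥0∞) ^ 2 = C * eLpNorm f 2 B.μ ^ 2 := by
      rw [← hN', ← ENNReal.coe_pow, mul_pow, NNReal.sq_sqrt, ENNReal.coe_mul, ENNReal.coe_pow]
    rw [annihilationFun, enorm_smul, mul_pow, h3, h5, ← mul_assoc, mul_assoc (C : ℝ≥0∞)]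
    exact mul_le_mul' h4 h2
  have h2 := B.eLpNorm_fock_le (s := 0) (t := -1) h1
  have h3 : eLpNorm (B.incl (t := -1) (by norm_num) (B.annihilation f Φ)).1 2 (B.fockMeasure (-1))
      = eLpNorm (B.annihilationFun f Φ.1) 2 (B.fockMeasure (-1)) :=
    eLpNorm_congr_ae ((B.ae_fockMeasure_iff _).2
      ((coeFn_incl _ _).trans (coeFn_annihilation f Φ)))
  have h4 : eLpNorm Φ₀.1 2 (B.fockMeasure 0) = eLpNorm Φ.1 2 (B.fockMeasure 0) :=
    eLpNorm_congr_ae ((B.ae_fockMeasure_iff _).2 (coeFn_incl _ _))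
  rw [← h3, ← h4] at h2
  rw [Submodule.coe_norm, Submodule.coe_norm, Lp.norm_def, Lp.norm_def, ← ENNReal.coe_toReal,
    ← ENNReal.toReal_mul]
  exact ENNReal.toReal_mono (ENNReal.mul_ne_top ENNReal.coe_ne_top (Lp.eLpNorm_ne_top _)) h2

theorem inner_atomOp_adjoint [CompleteSpace h] [CompleteSpace h'] (L : h →L[ℂ] h')
    (Ψ : B.Fock h' 0) (Φ : B.Fock h 0) :
    inner ℂ (B.atomOp 0 (ContinuousLinearMap.adjoint L) Ψ) Φ = inner ℂ Ψ (B.atomOp 0 L Φ) := by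
  rw [inner_fock_zero, inner_fock_zero]
  refine integral_congr_ae ?_
  filter_upwards [coeFn_atomOp 0 (ContinuousLinearMap.adjoint L) Ψ, coeFn_atomOp 0 L Φ]
    with γ a1 a2
  rw [a1, a2, ContinuousLinearMap.adjoint_inner_left]

theorem annihilation_atomOp [CompleteSpace h] [CompleteSpace h'] (L : h →L[ℂ] h')
    (f : B.HScale (-1)) (Φ : B.Fock h 1) :
    B.annihilation f (B.atomOp 1 L Φ) = B.atomOp 0 L (B.annihilation f Φ) := by
  refine fock_ext ?_
  filter_upwards [coeFn_annihilation f (B.atomOp 1 L Φ), coeFn_atomOp 0 L (B.annihilation f Φ),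
    coeFn_annihilation f Φ, B.ae_snoc (coeFn_atomOp 1 L Φ), B.integrable_fiber f Φ]
    with γ a1 a2 a3 a4 a5
  rw [a1, a2, a3, annihilationFun, annihilationFun, map_smul, ← L.integral_comp_comm a5]
  congr 1
  refine integral_congr_ae (a4.mono fun k hk => ?_)
  simp only [hk, map_smul]

theorem dense_range_incl [CompleteSpace h] :
    Dense (LinearMap.range (B.incl (s := 1) (t := 0) (by norm_num) :
      B.Fock h 1 →L[ℂ] B.Fock h 0).toLinearMap : Set (B.Fock h 0)) := by
  rw [Submodule.dense_iff_topologicalClosure_eq_top, Submodule.topologicalClosure_eq_top_iff,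
    Submodule.eq_bot_iff]
  intro Ψ hΨ
  have h1 : B.incl (t := -1) (by norm_num) Ψ = B.incl (t := -1) (by norm_num) (0 : B.Fock h 0) := by
    refine eq_of_pairing_eq fun Φ => ?_
    rw [pairing_incl_left, pairing_incl_left, inner_zero_left]
    exact (Submodule.mem_orthogonal' _ _).1 hΨ _ (LinearMap.mem_range_self _ Φ)
  exact B.incl_injective _ h1

variable [CompleteSpace h]

/-- For `f ∈ L²` the creation operator is defined on all of `h ⊗ F_1`. -/
theorem incl_mem_domain_creationOp {f : B.HScale (-1)} (hf : MemLp f 2 B.μ) (χ : B.Fock h 1) :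
    B.incl (by norm_num) χ ∈ (B.creationOp h f).domain := by
  obtain ⟨C, hC⟩ := exists_norm_incl_annihilation_le (h := h) hf
  rw [creationOp, LinearPMap.mem_adjoint_domain_iff]
  refine AddMonoidHomClass.continuous_of_bound _
    (‖(B.numPow (-(1 / 2)) (by norm_num) : B.Fock h (-1) →L[ℂ] B.Fock h 0)‖ * C
      * ‖B.numPow (t := 0) (1 / 2) (by norm_num) χ‖) ?_
  rintro ⟨_, Φ, rfl⟩
  have h1 : (B.annihilationOp h f).toFun ⟨_, Φ, rfl⟩ = B.annihilation f Φ :=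
    LinearPMap.ofParam_apply _ _ _ Φ
  rw [LinearMap.comp_apply, h1]
  change ‖inner ℂ (B.incl (t := 0) (by norm_num) χ) (B.annihilation f Φ)‖
    ≤ _ * ‖B.incl (t := 0) (by norm_num) Φ‖
  rw [← inner_fock_conj_symm, ← pairing_incl_left, RCLike.norm_conj, pairing]
  refine (norm_inner_fock_le _ _).trans ?_
  rw [mul_right_comm]
  gcongr
  refine (ContinuousLinearMap.le_opNorm _ _).trans ?_
  rw [mul_assoc]
  gcongr
  exact hC Φ

theorem inner_creationOp {f : B.HScale (-1)} (hf : MemLp f 2 B.μ) (χ Φ : B.Fock h 1) :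
    inner ℂ (B.creationOp h f ⟨_, incl_mem_domain_creationOp hf χ⟩) (B.incl (by norm_num) Φ)
      = inner ℂ (B.incl (t := 0) (by norm_num) χ) (B.annihilation f Φ) := by
  have h1 := (B.annihilationOp h f).adjoint_isFormalAdjoint dense_range_incl
    ⟨_, incl_mem_domain_creationOp hf χ⟩ ⟨_, LinearMap.mem_range_self _ Φ⟩
  refine h1.trans ?_
  congr 1
  exact LinearPMap.ofParam_apply _ _ _ Φ

end BosonField

/-! ### The regular Hamiltonian -/

theorem LinearPMap.add_mem_graph_add {E F : Type*} [AddCommGroup E] [Module ℂ E] [AddCommGroup F]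
    [Module ℂ F] {T T' : E →ₗ.[ℂ] F} {x : E} {y y' : F} (h : (x, y) ∈ T.graph)
    (h' : (x, y') ∈ T'.graph) : (x, y + y') ∈ (T + T').graph := by
  obtain ⟨a, rfl, rfl⟩ := (LinearPMap.mem_graph_iff _).1 h
  obtain ⟨b, hb, rfl⟩ := (LinearPMap.mem_graph_iff _).1 h'
  obtain ⟨b, hb'⟩ := b
  obtain rfl : b = a := hb
  exact (LinearPMap.mem_graph_iff _).2 ⟨⟨a, a.2, hb'⟩, rfl, rfl⟩

theorem LinearPMap.sum_mem_graph_sum {ι E F : Type*} [AddCommGroup E] [Module ℂ E]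
    [AddCommGroup F] [Module ℂ F] (s : Finset ι) {T : ι → E →ₗ.[ℂ] F} {x : E} {y : ι → F}
    (h : ∀ i, (x, y i) ∈ (T i).graph) : (x, ∑ i ∈ s, y i) ∈ (∑ i ∈ s, T i).graph := by
  classical
  induction s using Finset.induction_on with
  | empty => exact (LinearPMap.mem_graph_iff _).2 ⟨⟨x, trivial⟩, rfl, rfl⟩
  | insert i s hi ih =>
    rw [Finset.sum_insert hi, Finset.sum_insert hi]
    exact LinearPMap.add_mem_graph_add (h i) ih

theorem LinearPMap.smul_mem_graph_smul {E F : Type*} [AddCommGroup E] [Module ℂ E]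
    [AddCommGroup F] [Module ℂ F] {T : E →ₗ.[ℂ] F} {x : E} {y : F} (c : ℂ)
    (h : (x, y) ∈ T.graph) : (x, c • y) ∈ (c • T).graph := by
  obtain ⟨a, rfl, rfl⟩ := (LinearPMap.mem_graph_iff _).1 h
  exact (LinearPMap.mem_graph_iff _).2 ⟨a, rfl, rfl⟩

namespace BosonField

variable {X : Type*} [MeasurableSpace X] {B : BosonField X}
variable {he hg : Type*} [NormedAddCommGroup he] [InnerProductSpace ℂ he]
  [NormedAddCommGroup hg] [InnerProductSpace ℂ hg]
variable {Ee : he →L[ℂ] he} {Eg : hg →L[ℂ] hg} {r : ℕ} {S : Fin r → hg →L[ℂ] he} {lam : ℝ}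
  {f : Fin r → B.HScale (-1)}

theorem mem_graph_freeHamiltonian_iff {p : B.TotalSpace he hg × B.TotalSpace he hg} :
    p ∈ (B.freeHamiltonian Ee Eg).graph ↔ ∃ (χ : B.Fock he 2) (Φ : B.Fock hg 2),
      WithLp.toLp 2 (B.incl (by norm_num) χ, B.incl (by norm_num) Φ) = p.1 ∧
      WithLp.toLp 2 (B.free Ee (by norm_num) χ, B.free Eg (by norm_num) Φ) = p.2 := by
  rw [freeHamiltonian, LinearPMap.mem_graph_ofParam, Prod.exists]
  rfl

variable [CompleteSpace he] [CompleteSpace hg]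

/-- For form factors in `L²`, `A_f†` maps `h_e ⊗ F_1` to `h_g ⊗ F` and is given there by the
creation operators. -/
theorem couplingDag_incl (hf : ∀ j, MemLp (f j) 2 B.μ) (χ : B.Fock he 1) :
    B.couplingDag S f (B.incl (by norm_num) χ) = B.incl (by norm_num)
      (∑ j, B.atomOp 0 (ContinuousLinearMap.adjoint (S j))
        (B.creationOp he (f j) ⟨_, incl_mem_domain_creationOp (hf j) χ⟩)) := by
  refine eq_of_pairing_eq fun Φ => ?_
  rw [pairing_couplingDag, pairing_incl_left, coupling, sum_apply, inner_sum, sum_inner]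
  refine Finset.sum_congr rfl fun j _ => ?_
  rw [inner_atomOp_adjoint, ContinuousLinearMap.comp_apply, ← annihilation_atomOp, ← incl_atomOp,
    inner_creationOp (hf j)]

theorem mem_graph_interaction {S : hg →L[ℂ] he} {f : B.HScale (-1)} (hf : MemLp f 2 B.μ)
    (χ : B.Fock he 1) (η : B.Fock hg 1) :
    (WithLp.toLp 2 (B.incl (by norm_num) χ, B.incl (by norm_num) η),
      WithLp.toLp 2 (B.atomOp 0 S (B.annihilation f η),
        B.atomOp 0 (ContinuousLinearMap.adjoint S)
          (B.creationOp he f ⟨_, incl_mem_domain_creationOp hf χ⟩))) ∈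
      (B.interaction S f).graph := by
  refine (LinearPMap.mem_graph_iff _).2
    ⟨⟨WithLp.toLp 2 (B.incl (by norm_num) χ, B.incl (by norm_num) η),
      incl_mem_domain_creationOp hf χ, LinearMap.mem_range_self _ η⟩, rfl, ?_⟩
  have h1 : B.annihilationOp hg f ⟨_, LinearMap.mem_range_self _ η⟩ = B.annihilation f η :=
    LinearPMap.ofParam_apply _ _ _ η
  rw [← h1]
  rfl

/-- The action of the regular Hamiltonian on `D(h_e) ⊕ D(h_g)`, with `D = A_f† χ ∈ h_g ⊗ F`. -/
theorem mem_graph_regularHamiltonian (hf : ∀ j, MemLp (f j) 2 B.μ) (χ : B.Fock he 2)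
    (Φ : B.Fock hg 2) :
    ∃ D : B.Fock hg 0, B.couplingDag S f (B.incl (by norm_num) χ) = B.incl (by norm_num) D ∧
    (WithLp.toLp 2 (B.incl (by norm_num) χ, B.incl (by norm_num) Φ),
      WithLp.toLp 2 (B.free Ee (by norm_num) χ
          + (lam : ℂ) • B.coupling S f (B.incl (by norm_num) Φ),
        B.free Eg (by norm_num) Φ + (lam : ℂ) • D)) ∈
      (B.regularHamiltonian Ee Eg S lam f).graph := by
  have h0 := couplingDag_incl (S := S) hf (B.incl (by norm_num) χ)
  rw [← incl_incl (t := 1) (by norm_num) (by norm_num) χ,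
    ← incl_incl (t := 1) (by norm_num) (by norm_num) Φ]
  refine ⟨_, h0, ?_⟩
  have h1 : (WithLp.toLp 2 (B.incl (by norm_num) χ, B.incl (by norm_num) Φ),
      WithLp.toLp 2 (B.free Ee (by norm_num) χ, B.free Eg (by norm_num) Φ)) ∈
      (B.freeHamiltonian Ee Eg).graph := mem_graph_freeHamiltonian_iff.2 ⟨χ, Φ, rfl, rfl⟩
  rw [← incl_incl (t := 1) (by norm_num) (by norm_num) χ,
    ← incl_incl (t := 1) (by norm_num) (by norm_num) Φ] at h1
  have h2 := LinearPMap.sum_mem_graph_sum Finset.univ fun j =>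
    mem_graph_interaction (S := S j) (hf j) (B.incl (by norm_num) χ) (B.incl (by norm_num) Φ)
  rw [← WithLp.toLp_sum, ← prod_mk_sum] at h2
  have h3 := LinearPMap.add_mem_graph_add h1 (LinearPMap.smul_mem_graph_smul (lam : ℂ) h2)
  rw [coupling, sum_apply]
  exact h3

theorem domain_regularHamiltonian (hf : ∀ j, MemLp (f j) 2 B.μ) :
    (B.regularHamiltonian Ee Eg S lam f).domain = (B.freeHamiltonian Ee Eg).domain := by
  refine le_antisymm inf_le_left fun x hx => ?_
  obtain ⟨χ, Φ, rfl, -⟩ :=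
    mem_graph_freeHamiltonian_iff.1
      (LinearPMap.mem_graph _ (⟨x, hx⟩ : (B.freeHamiltonian Ee Eg).domain))
  obtain ⟨D, -, h⟩ := mem_graph_regularHamiltonian (S := S) (Ee := Ee) (Eg := Eg)
    (lam := lam) hf χ Φ
  exact LinearPMap.mem_domain_of_mem_graph h

/-- For `f ∈ L²` the condition `h_g η + λ A_f† χ ∈ F` on the domain of the singular Hamiltonian
reduces to `η ∈ D(h_g)`, because `A_f† χ` itself lies in `F`. -/
theorem singularHamiltonian_eq_regularHamiltonian [FiniteDimensional ℂ hg] (hEg : Eg.IsPositive)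
    (hf : ∀ j, MemLp (f j) 2 B.μ) :
    B.singularHamiltonian Ee Eg S lam f = B.regularHamiltonian Ee Eg S lam f := by
  refine LinearPMap.eq_of_eq_graph (le_antisymm ?_ ?_)
  · rintro ⟨Ψ, Θ⟩ h
    obtain ⟨χ, η, rfl, h1, h2⟩ := (mem_graph_singularHamiltonian_iff hEg).1 h
    obtain ⟨D, hD, -⟩ := mem_graph_regularHamiltonian (S := S) (Ee := Ee) (Eg := Eg) (lam := lam)
      hf χ 0
    rw [hD, ← map_smul] at h2
    obtain ⟨Φ, rfl, h3⟩ := exists_incl_eq_of_free_eq_incl hEg (η := η)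
      (Θ := Θ.snd - (lam : ℂ) • D) (by rw [map_sub, ← h2, add_sub_cancel_right])
    obtain ⟨D', hD', h4⟩ := mem_graph_regularHamiltonian (S := S) (Ee := Ee) (Eg := Eg)
      (lam := lam) hf χ Φ
    obtain rfl : D = D' := B.incl_injective _ (hD.symm.trans hD')
    rw [h1, h3, sub_add_cancel] at h4
    rw [incl_incl]
    exact h4
  · rintro ⟨Ψ, Θ⟩ h
    have hΨ : Ψ ∈ (B.freeHamiltonian Ee Eg).domain :=
      (domain_regularHamiltonian hf).le (LinearPMap.mem_domain_of_mem_graph h)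
    obtain ⟨χ, Φ, h1, -⟩ :=
      mem_graph_freeHamiltonian_iff.1
        (LinearPMap.mem_graph _ (⟨Ψ, hΨ⟩ : (B.freeHamiltonian Ee Eg).domain))
    simp only at h1
    subst h1
    obtain ⟨D, hD, h2⟩ := mem_graph_regularHamiltonian (S := S) (Ee := Ee) (Eg := Eg)
      (lam := lam) hf χ Φ
    obtain rfl := LinearPMap.mem_graph_snd_inj _ h h2 rfl
    refine (mem_graph_singularHamiltonian_iff hEg).2 ⟨χ, B.incl (by norm_num) Φ, ?_, rfl, ?_⟩
    · rw [incl_incl]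
    · rw [hD, free_incl]
      change _ = B.incl _ (_ + _)
      rw [map_add, map_smul, incl_free]

end BosonField

namespace BosonField

variable {X : Type*} [MeasurableSpace X] {B : BosonField X}

/-! ### Approximation by form factors in `L²` -/

theorem ac_hScaleMeasure (B : BosonField X) (s : ℝ) :
    B.μ ≪ B.μ.withDensity fun k => ENNReal.ofReal (B.ω k ^ s) :=
  withDensity_absolutelyContinuous' (B.measurable_ω.pow_const s).ennreal_ofReal.aemeasurable
    (ae_of_all _ fun k => by
      have := B.ω_pos k
      simp only [ne_eq, ENNReal.ofReal_eq_zero, not_le]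
      positivity)

/-- Where `ω ≤ c`, the measure `μ` is dominated by `c ω⁻¹ μ`. -/
theorem restrict_le_hScaleMeasure (B : BosonField X) (c : ℝ) :
    B.μ.restrict {k | B.ω k ≤ c} ≤
      ENNReal.ofReal c • B.μ.withDensity fun k => ENNReal.ofReal (B.ω k ^ (-1 : ℝ)) := by
  have hs : MeasurableSet {k | B.ω k ≤ c} := measurableSet_le B.measurable_ω measurable_const
  refine Measure.le_iff.2 fun t ht => ?_
  rw [Measure.restrict_apply ht, Measure.smul_apply, withDensity_apply _ ht, smul_eq_mul,
    ← lintegral_const_mul _ (B.measurable_ω.pow_const _).ennreal_ofReal, ← setLIntegral_one]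
  refine le_trans ?_ (lintegral_mono_set (Set.inter_subset_left (t := {k | B.ω k ≤ c})))
  refine setLIntegral_mono' (ht.inter hs) fun k hk => ?_
  have h1 := B.ω_pos k
  have h2 : B.ω k ≤ c := hk.2
  rw [← ENNReal.ofReal_mul (h1.le.trans h2), Real.rpow_neg_one, ← div_eq_mul_inv]
  exact ENNReal.one_le_ofReal.2 ((one_le_div h1).2 h2)

/-- `L²` is dense in `H_{-1}`: cut off the form factor where `ω` is large. -/
theorem exists_tendsto_memLp_two (f : B.HScale (-1)) :
    ∃ F : ℕ → B.HScale (-1), (∀ i, MemLp (F i) 2 B.μ) ∧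
      Tendsto (fun i => ‖F i - f‖) atTop (𝓝 0) := by
  set ν := B.μ.withDensity fun k => ENNReal.ofReal (B.ω k ^ (-1 : ℝ)) with hν
  let s : ℕ → Set X := fun i => {k | B.ω k ≤ i}
  have hs : ∀ i, MeasurableSet (s i) := fun i => measurableSet_le B.measurable_ω measurable_const
  have hf : MemLp f 2 ν := Lp.memLp f
  have hF : ∀ i, MemLp ((s i).indicator f) 2 ν := fun i => hf.indicator (hs i)
  refine ⟨fun i => (hF i).toLp, fun i => ?_, ?_⟩
  · refine (memLp_congr_ae ((B.ac_hScaleMeasure (-1)).ae_le (hF i).coeFn_toLp)).2 ?_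
    rw [memLp_indicator_iff_restrict (hs i)]
    exact hf.of_measure_le_smul ENNReal.ofReal_ne_top (B.restrict_le_hScaleMeasure i)
  · have h1 : ∀ i, ‖(hF i).toLp - f‖ = (eLpNorm ((s i).indicator f - ⇑f) 2 ν).toReal := by
      intro i
      rw [Lp.norm_def]
      congr 1
      refine eLpNorm_congr_ae ((Lp.coeFn_sub _ _).trans ?_)
      filter_upwards [(hF i).coeFn_toLp] with k hk
      rw [Pi.sub_apply, Pi.sub_apply, hk]
    have h2 : Tendsto (fun i => ∫⁻ k, ‖((s i).indicator f - ⇑f) k‖ₑ ^ 2 ∂ν) atTop (𝓝 0) := by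
      have h3 : Tendsto (fun i => ∫⁻ k, ‖((s i).indicator f - ⇑f) k‖ₑ ^ 2 ∂ν) atTop
          (𝓝 (∫⁻ _, 0 ∂ν)) := by
        refine tendsto_lintegral_of_dominated_convergence' (fun k => ‖f k‖ₑ ^ 2)
          (fun i => (((hF i).1.sub hf.1).enorm.pow_const 2)) (fun i => ae_of_all _ fun k => ?_) ?_
          (ae_of_all _ fun k => ?_)
        · by_cases hk : k ∈ s i <;> simp [hk]
        · have h4 : eLpNorm f 2 ν ^ 2 = ∫⁻ k, ‖f k‖ₑ ^ 2 ∂ν := by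
            simpa using eLpNorm_nnreal_pow_eq_lintegral (f := f) (μ := ν) (p := 2) (by norm_num)
          rw [← h4]
          exact (ENNReal.pow_lt_top hf.2).ne
        · obtain ⟨n, hn⟩ := exists_nat_ge (B.ω k)
          refine tendsto_const_nhds.congr' ?_
          filter_upwards [eventually_ge_atTop n] with i hi
          have hk : k ∈ s i := hn.trans (by exact_mod_cast hi)
          simp [hk]
      simpa using h3
    have h5 : Tendsto (fun i => eLpNorm ((s i).indicator f - ⇑f) 2 ν) atTop (𝓝 0) := by
      have h6 : ∀ i, eLpNorm ((s i).indicator f - ⇑f) 2 ν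
          = (∫⁻ k, ‖((s i).indicator f - ⇑f) k‖ₑ ^ 2 ∂ν) ^ (1 / 2 : ℝ) := by
        intro i
        simpa using eLpNorm_nnreal_eq_lintegral (f := (s i).indicator f - ⇑f) (μ := ν)
          (p := 2) (by norm_num)
      simp_rw [h6]
      have := (ENNReal.continuous_rpow_const (y := 1 / 2)).continuousAt.tendsto.comp h2
      simpa [Function.comp_def] using this
    simp_rw [h1]
    exact (ENNReal.tendsto_toReal ENNReal.zero_ne_top).comp h5

/-! ### Norm resolvent convergence -/

section Annihilation

variable {h : Type*} [NormedAddCommGroup h] [InnerProductSpace ℂ h]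

theorem norm_annihilation_le (f : B.HScale (-1)) :
    ‖(B.annihilation f : B.Fock h 1 →L[ℂ] B.Fock h 0)‖ ≤ ‖f‖ := by
  unfold annihilation mkFock
  exact LinearMap.mkContinuous_norm_le _ (norm_nonneg f) _

theorem annihilation_sub (f g : B.HScale (-1)) :
    (B.annihilation (f - g) : B.Fock h 1 →L[ℂ] B.Fock h 0)
      = B.annihilation f - B.annihilation g := by
  ext1 Φ
  refine fock_ext ?_
  have h0 : ∀ᵐ k ∂B.μ, (f - g) k = f k - g k := (B.ac_hScaleMeasure (-1)).ae_le (Lp.coeFn_sub f g)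
  filter_upwards [coeFn_annihilation (f - g) Φ, coeFn_annihilation f Φ, coeFn_annihilation g Φ,
    coeFn_fock_sub (B.annihilation f Φ) (B.annihilation g Φ), B.integrable_fiber f Φ,
    B.integrable_fiber g Φ] with γ a1 a2 a3 a4 a5 a6
  rw [sub_apply, a1, a4, a2, a3]
  simp only [annihilationFun]
  rw [← smul_sub, ← integral_sub a5 a6]
  congr 1
  refine integral_congr_ae (h0.mono fun k hk => ?_)
  simp only [hk, map_sub, sub_smul]

theorem continuous_annihilation :
    Continuous fun f => (B.annihilation f : B.Fock h 1 →L[ℂ] B.Fock h 0) := by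
  have hL : LipschitzWith 1 fun f => (B.annihilation f : B.Fock h 1 →L[ℂ] B.Fock h 0) := by
    refine LipschitzWith.of_dist_le_mul fun f g => ?_
    rw [dist_eq_norm, dist_eq_norm, ← annihilation_sub, NNReal.coe_one, one_mul]
    exact norm_annihilation_le _
  exact hL.continuous

theorem continuous_coupling {h' : Type*} [NormedAddCommGroup h'] [InnerProductSpace ℂ h'] {r : ℕ}
    {S : Fin r → h →L[ℂ] h'} : Continuous fun f : Fin r → B.HScale (-1) => B.coupling S f := by
  unfold coupling
  exact continuous_finsetSum _ fun j _ =>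
    continuous_const.clm_comp (continuous_annihilation.comp (continuous_apply j))

end Annihilation

variable {he hg : Type*} [NormedAddCommGroup he] [InnerProductSpace ℂ he] [CompleteSpace he]
  [NormedAddCommGroup hg] [InnerProductSpace ℂ hg] [CompleteSpace hg]
variable {Ee : he →L[ℂ] he} {Eg : hg →L[ℂ] hg} {r : ℕ} {S : Fin r → hg →L[ℂ] he} {lam : ℝ}
  {z : ℂ}

theorem continuous_couplingDag :
    Continuous fun f : Fin r → B.HScale (-1) => B.couplingDag S f := by
  unfold couplingDag pairingAdjoint
  exact continuous_const.clm_comp (ContinuousLinearMap.adjoint.continuous.comp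
    (continuous_coupling.clm_comp continuous_const))

theorem continuous_selfEnergy :
    Continuous fun f : Fin r → B.HScale (-1) => B.selfEnergy Eg S f z := by
  unfold selfEnergy
  exact continuous_coupling.clm_comp (continuous_const.clm_comp continuous_couplingDag)

variable [FiniteDimensional ℂ he] [FiniteDimensional ℂ hg]

theorem continuous_inverse_propagatorInv (hEe : Ee.IsPositive) (hEg : Eg.IsPositive)
    (hz : z.im ≠ 0) :
    Continuous fun f : Fin r → B.HScale (-1) => (B.propagatorInv Ee Eg S lam f z).inverse := by
  have h1 : Continuous fun f : Fin r → B.HScale (-1) => B.propagatorInv Ee Eg S lam f z := by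
    have h3 := (continuous_selfEnergy (B := B) (S := S) (Eg := Eg) (z := z)).clm_comp
      (continuous_const (y := (B.incl (by norm_num) : B.Fock he 2 →L[ℂ] B.Fock he 0)))
    exact continuous_const.sub (h3.const_smul ((lam : ℂ) ^ 2))
  refine continuous_iff_continuousAt.2 fun f => ?_
  have h2 := (isInvertible_propagatorInv (B := B) (S := S) (lam := lam) (f := f)
    hEe hEg hz).contDiffAt_map_inverse (𝕜 := ℂ) (n := 0)
  exact ContinuousAt.comp (g := ContinuousLinearMap.inverse)
    (f := fun f => B.propagatorInv Ee Eg S lam f z) h2.continuousAt h1.continuousAt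

set_option synthInstance.maxHeartbeats 200000 in
set_option maxHeartbeats 1000000 in
/-- The resolvent depends continuously, in operator norm, on the form factors in `H_{-1}`. -/
theorem continuous_resolventOp (hEe : Ee.IsPositive) (hEg : Eg.IsPositive) (hz : z.im ≠ 0) :
    Continuous fun f : Fin r → B.HScale (-1) => B.resolventOp Ee Eg S lam f z := by
  have h1 := continuous_inverse_propagatorInv (B := B) (S := S) (lam := lam) hEe hEg hz
  have h2 := continuous_coupling (B := B) (S := S)
  have h3 := continuous_couplingDag (B := B) (S := S)
  let Rg : B.TotalSpace he hg →L[ℂ] B.Fock hg 1 :=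
    B.freeResolvent Eg z ∘L B.incl (by norm_num) ∘L WithLp.sndL 2 ℂ (B.Fock he 0) (B.Fock hg 0)
  let χ : (Fin r → B.HScale (-1)) → B.TotalSpace he hg →L[ℂ] B.Fock he 0 := fun f =>
    B.incl (s := 2) (by norm_num) ∘L (B.propagatorInv Ee Eg S lam f z).inverse ∘L
      (WithLp.fstL 2 ℂ (B.Fock he 0) (B.Fock hg 0) - (lam : ℂ) • (B.coupling S f ∘L Rg))
  have hχ : Continuous χ := by
    have h4 : Continuous fun f => B.coupling S f ∘L Rg := h2.clm_comp continuous_const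
    exact continuous_const.clm_comp (h1.clm_comp (continuous_const.sub (h4.const_smul (lam : ℂ))))
  let i : B.Fock hg 1 →L[ℂ] B.Fock hg 0 := B.incl (by norm_num)
  have hη : Continuous fun f =>
      i ∘L Rg - (lam : ℂ) • (i ∘L B.freeResolvent Eg z ∘L B.couplingDag S f ∘L χ f) := by
    have h4 : Continuous fun f => i ∘L B.freeResolvent Eg z ∘L B.couplingDag S f ∘L χ f :=
      continuous_const.clm_comp (continuous_const.clm_comp (h3.clm_comp hχ))
    exact continuous_const.sub (h4.const_smul (lam : ℂ))
  have hp := (ContinuousLinearMap.prodL ℂ (𝕜 := ℂ) (E := B.TotalSpace he hg)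
    (F := B.Fock he 0) (G := B.Fock hg 0)).continuous.comp (hχ.prodMk hη)
  exact continuous_const.clm_comp hp

end BosonField

end

theorem mainTheorem1 {X : Type*} [MeasurableSpace X] (B : BosonField X)
    {he hg : Type*} [NormedAddCommGroup he] [InnerProductSpace ℂ he] [CompleteSpace he]
    [FiniteDimensional ℂ he] [NormedAddCommGroup hg] [InnerProductSpace ℂ hg] [CompleteSpace hg]
    [FiniteDimensional ℂ hg]
    (Ee : he →L[ℂ] he) (Eg : hg →L[ℂ] hg) (hEe : Ee.IsPositive) (hEg : Eg.IsPositive)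
    {r : ℕ} (S : Fin r → hg →L[ℂ] he) (lam : ℝ) (f : Fin r → B.HScale (-1)) :
    -- the inverse `(h_g + 1)⁻¹` used in the definition exists, and the operator is self-adjoint
    (B.freeSub Eg (-1)).IsInvertible ∧
    IsSelfAdjoint (B.singularHamiltonian Ee Eg S lam f) ∧
    -- the resolvent
    (∀ z : ℂ, z.im ≠ 0 →
      (B.freeSub Eg z).IsInvertible ∧
      (B.propagatorInv Ee Eg S lam f z).IsInvertible ∧
      ∃ R : B.TotalSpace he hg →L[ℂ] B.TotalSpace he hg,
        IsResolventAt (E := B.TotalSpace he hg)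
          (B.singularHamiltonian Ee Eg S lam f) z R ∧
        ∀ (Ψe : B.Fock he 0) (Ψg : B.Fock hg 0),
          R (WithLp.toLp 2 (Ψe, Ψg)) = B.resolventFormula Ee Eg S lam f z Ψe Ψg) ∧
    -- reduction to the regular model
    ((∀ j, MemLp (f j) 2 B.μ) →
      B.singularHamiltonian Ee Eg S lam f = B.regularHamiltonian Ee Eg S lam f ∧
      (B.regularHamiltonian Ee Eg S lam f).domain = (B.freeHamiltonian Ee Eg).domain) ∧
    -- approximation by regular models
    (∃ F : ℕ → Fin r → B.HScale (-1), (∀ i j, MemLp (F i j) 2 B.μ) ∧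
      ∀ j, Tendsto (fun i => ‖F i j - f j‖) atTop (𝓝 0)) ∧
    (∀ F : ℕ → Fin r → B.HScale (-1), (∀ i j, MemLp (F i j) 2 B.μ) →
      (∀ j, Tendsto (fun i => ‖F i j - f j‖) atTop (𝓝 0)) →
      NormResolventTendsto (E := B.TotalSpace he hg)
        (fun i => B.regularHamiltonian Ee Eg S lam (F i))
        (B.singularHamiltonian Ee Eg S lam f)) := by
  refine ⟨BosonField.isInvertible_freeSub hEg BosonField.offHalfLine_neg_one,
    BosonField.isSelfAdjoint_singularHamiltonian hEe hEg, fun z hz => ⟨?_, ?_, ?_⟩,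
    fun hf => ⟨BosonField.singularHamiltonian_eq_regularHamiltonian hEg hf,
      BosonField.domain_regularHamiltonian hf⟩, ?_, fun F hF hFf z hz => ?_⟩
  · exact BosonField.isInvertible_freeSub hEg (BosonField.offHalfLine_of_im_ne_zero hz)
  · exact BosonField.isInvertible_propagatorInv hEe hEg hz
  · exact ⟨B.resolventOp Ee Eg S lam f z, BosonField.isResolventAt_resolventOp hEe hEg hz,
      fun Ψe Ψg => BosonField.resolventOp_apply Ψe Ψg⟩
  · choose F hF hFf using fun j => BosonField.exists_tendsto_memLp_two (f j)
    exact ⟨fun i j => F j i, fun i j => hF j i, hFf⟩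
  · refine ⟨fun i => B.resolventOp Ee Eg S lam (F i) z, B.resolventOp Ee Eg S lam f z,
      fun i => ?_, BosonField.isResolventAt_resolventOp hEe hEg hz, ?_⟩
    · beta_reduce
      rw [← BosonField.singularHamiltonian_eq_regularHamiltonian hEg (hF i)]
      exact BosonField.isResolventAt_resolventOp hEe hEg hz
    · have hlim : Tendsto F atTop (𝓝 f) := tendsto_pi_nhds.2 fun j =>
        tendsto_iff_norm_sub_tendsto_zero.2 (hFf j)
      exact ((BosonField.continuous_resolventOp hEe hEg hz).tendsto f).comp hlim
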